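/- For a partition $\mu$ and $h\ge 0$, let $s_\mu[s_h](x_0,x_1)$ be the plethysm of the Schur polynomials $s_\mu$ and $s_h=s_{(h)}$ in two variables, that is, $s_\mu$ evaluated at the monomials of $s_h(x_0,x_1)$. For $n\ge 0$ put $[n]_q=\frac{q^n-q^{-n}}{q-q^{-1}}$. The $\mathrm{SL}_2$-plethysm coefficients $a_{\mu[h]}^{[k]}\in\mathbb{Z}$ ($k\ge 1$) are the coefficients of the expansion $$s_\mu[s_h](q,q^{-1})=\sum_{k\ge 1}a_{\mu[h]}^{[k]}\,[k]_q ,$$ and their generating function is the formal power series $$A_\mu(z,q)=\sum_{k\ge 1,\ h\ge 0}a_{\mu[h]}^{[k]}\,q^k z^h\in\mathbb{Z}[[z,q]].$$ **Theorem.** Let $w>0$ be an integer. For $w$ even put $$d_w(z,q)=(1-z)\prod_{i=1}^w(1-z^i)\prod_{i=1}^{w/2}(1-q^{2i}z),$$ and for $w$ odd put $$d_w(z,q)=\prod_{i=1}^w(1-z^{2i})\prod_{i=1}^{(w+1)/2}(1-q^{2i-1}z).$$ Then for every partition $\mu\vdash w$, $$d_w(z,q)\,A_\mu(z,q)\in\mathbb{Z}[z,q].$$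 -/

import Mathlib

namespace SL2Plethysm

/-- Semistandard Young tableaux of shape `μ` over the alphabet `{0, …, N - 1}`. (Mathlib's tableaux
have arbitrary natural numbers as entries, and are extended by zero outside `μ`.) -/
abbrev SSYT (N : ℕ) (μ : YoungDiagram) : Type :=
  {T : SemistandardYoungTableau μ // ∀ c ∈ μ.cells, T c.1 c.2 < N}

instance SSYT.finite (N : ℕ) (μ : YoungDiagram) : Finite (SSYT N μ) := by
  refine Finite.of_injective
    (fun (T : SSYT N μ) (c : μ.cells) => (⟨T.1 c.1.1 c.1.2, T.2 c.1 c.2⟩ : Fin N)) ?_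
  intro T T' h
  apply Subtype.ext
  ext i j
  by_cases hc : (i, j) ∈ μ
  · have := congrFun h ⟨(i, j), (μ.mem_cells _).2 hc⟩
    simpa using this
  · rw [T.1.zeros hc, T'.1.zeros hc]

noncomputable instance SSYT.fintype (N : ℕ) (μ : YoungDiagram) : Fintype (SSYT N μ) :=
  Fintype.ofFinite _

/-- The monomial `x^{wt T} = ∏_{c ∈ μ} x_{T(c)}` of a tableau. -/
noncomputable def SSYT.monomial {N : ℕ} {μ : YoungDiagram} (T : SSYT N μ) :
    MvPolynomial (Fin N) ℤ :=
  ∏ c ∈ μ.cells.attach, MvPolynomial.X ⟨T.1 c.1.1 c.1.2, T.2 c.1 c.2⟩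

/-- The Schur polynomial `s_μ(x_0, …, x_{N-1})`. -/
noncomputable def schur (N : ℕ) (μ : YoungDiagram) : MvPolynomial (Fin N) ℤ :=
  ∑ T : SSYT N μ, T.monomial

/-- The plethysm `s_μ[s_ν](x_0, …, x_{n-1})` of Schur polynomials: write `s_ν(x_0, …, x_{n-1})` as
a sum of monomials (repeated according to multiplicity), here `x^{wt T}` for `T` running over the
tableaux of shape `ν`, and substitute these monomials for the variables of `s_μ`. The enumeration
of the monomials is immaterial because Schur polynomials are symmetric. -/
noncomputable def plethysm (n : ℕ) (μ ν : YoungDiagram) : MvPolynomial (Fin n) ℤ :=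
  MvPolynomial.aeval
    (fun i : Fin (Fintype.card (SSYT n ν)) => ((Fintype.equivFin (SSYT n ν)).symm i).monomial)
    (schur (Fintype.card (SSYT n ν)) μ)

/-- The one-row partition `(h)` (the empty partition for `h = 0`). -/
def row (h : ℕ) : YoungDiagram :=
  YoungDiagram.ofRowLens [h] (List.pairwise_singleton _ h).sortedGE

/-- The Laurent polynomial `s_μ[s_h](q, q⁻¹)`. -/
noncomputable def plethysmSL2 (μ : YoungDiagram) (h : ℕ) : LaurentPolynomial ℤ :=
  MvPolynomial.aeval ![LaurentPolynomial.T 1, LaurentPolynomial.T (-1)] (plethysm 2 μ (row h))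

/-- The `q`-integer `[n]_q = q^{n-1} + q^{n-3} + ⋯ + q^{1-n} = (q^n - q^{-n}) / (q - q⁻¹)`. -/
noncomputable def qInt (n : ℕ) : LaurentPolynomial ℤ :=
  ∑ i ∈ Finset.range n, LaurentPolynomial.T ((n : ℤ) - 1 - 2 * i)

theorem qInt_mul (n : ℕ) :
    qInt n * (LaurentPolynomial.T 1 - LaurentPolynomial.T (-1)) =
      LaurentPolynomial.T (n : ℤ) - LaurentPolynomial.T (-(n : ℤ)) := by
  have h : ∀ i : ℕ, (LaurentPolynomial.T ((n : ℤ) - 1 - 2 * i) : LaurentPolynomial ℤ) *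
      (LaurentPolynomial.T 1 - LaurentPolynomial.T (-1)) =
      LaurentPolynomial.T ((n : ℤ) - 2 * (i : ℕ)) -
        LaurentPolynomial.T ((n : ℤ) - 2 * ((i + 1 : ℕ) : ℤ)) := by
    intro i
    rw [mul_sub, ← LaurentPolynomial.T_add, ← LaurentPolynomial.T_add]
    congr 2
    · ring
    · push_cast
      ring
  rw [qInt, Finset.sum_mul, Finset.sum_congr rfl (fun i _ => h i),
    Finset.sum_range_sub' (fun i : ℕ =>
      (LaurentPolynomial.T ((n : ℤ) - 2 * (i : ℤ)) : LaurentPolynomial ℤ))]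
  ring_nf

/-- `F = ∑_{k ≥ 1} c_k [k]_q`, with the convention `c_0 = 0`. -/
def IsExpansion (F : LaurentPolynomial ℤ) (c : ℕ →₀ ℤ) : Prop :=
  c 0 = 0 ∧ F = c.sum fun k a => a • qInt k

theorem IsExpansion.coeff_eq {F : LaurentPolynomial ℤ} {c : ℕ →₀ ℤ} (hc : IsExpansion F c)
    {k : ℕ} (hk : 1 ≤ k) :
    c k = (F * (LaurentPolynomial.T 1 - LaurentPolynomial.T (-1))).coeff (k : ℤ) := by
  rw [hc.2, Finsupp.sum, Finset.sum_mul]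
  have h : ∀ j ∈ c.support,
      ((c j • qInt j * (LaurentPolynomial.T 1 - LaurentPolynomial.T (-1))).coeff (k : ℤ)) =
        if j = k then c j else 0 := by
    intro j _
    rw [smul_mul_assoc, qInt_mul, AddMonoidAlgebra.coeff_smul, AddMonoidAlgebra.coeff_sub,
      Finsupp.smul_apply, Finsupp.sub_apply]
    have h2 : ¬ (-(j : ℤ) = (k : ℤ)) := by omega
    simp [h2]
  simp only [AddMonoidAlgebra.coeff_sum, Finsupp.finsetSum_apply]
  rw [Finset.sum_congr rfl h]
  simp

/-- An expansion into `q`-integers is unique. -/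
theorem IsExpansion.unique {F : LaurentPolynomial ℤ} {c c' : ℕ →₀ ℤ} (hc : IsExpansion F c)
    (hc' : IsExpansion F c') : c = c' := by
  ext k
  rcases Nat.eq_zero_or_pos k with rfl | hk
  · rw [hc.1, hc'.1]
  · rw [hc.coeff_eq hk, hc'.coeff_eq hk]

open Classical in
/-- The `SL₂`-plethysm coefficient `a_{μ[h]}^{[k]}`: the coefficient of `[k]_q` in the expansion
`s_μ[s_h](q, q⁻¹) = ∑_{k ≥ 1} a_{μ[h]}^{[k]} [k]_q`, with `a_{μ[h]}^{[0]} = 0`. The expansion is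
unique, and it exists because `s_μ[s_h](x_0, x_1)` is symmetric. -/
noncomputable def coeff (μ : YoungDiagram) (h k : ℕ) : ℤ :=
  if hex : ∃ c : ℕ →₀ ℤ, IsExpansion (plethysmSL2 μ h) c then hex.choose k else 0

/-- The generating function `A_μ(z, q) = ∑_{k ≥ 1, h ≥ 0} a_{μ[h]}^{[k]} q^k z^h`, as a formal power
series in `z` (the variable `0`) and `q` (the variable `1`). -/
noncomputable def genFun (μ : YoungDiagram) : MvPowerSeries (Fin 2) ℤ :=
  fun m => if 1 ≤ m 1 then coeff μ (m 0) (m 1) else 0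

/-- The polynomial `d_w(z, q)`, where `z` is the variable `0` and `q` is the variable `1`. -/
noncomputable def denom (w : ℕ) : MvPolynomial (Fin 2) ℤ :=
  let z : MvPolynomial (Fin 2) ℤ := MvPolynomial.X 0
  let q : MvPolynomial (Fin 2) ℤ := MvPolynomial.X 1
  if Even w then
    (1 - z) * (∏ i ∈ Finset.Icc 1 w, (1 - z ^ i)) *
      ∏ i ∈ Finset.Icc 1 (w / 2), (1 - q ^ (2 * i) * z)
  else
    (∏ i ∈ Finset.Icc 1 w, (1 - z ^ (2 * i))) *
      ∏ i ∈ Finset.Icc 1 ((w + 1) / 2), (1 - q ^ (2 * i - 1) * z)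

end SL2Plethysm

/-!
Write `w = |μ|`. Enumerating the monomials of `s_h(q, q⁻¹)` gives
`s_μ[s_h](q, q⁻¹) = s_μ(q^{-h}, q^{-h+2}, …, q^h)`, and the coefficient of `q^k` for `k ≥ 1` in
`(q - q⁻¹) s_μ[s_h](q, q⁻¹)` is the plethysm coefficient `a_{μ[h]}^{[k]}` (`coeff_eq`). Thus `A_μ`
is the positive part, with respect to `q`, of `∑ h, (q - q⁻¹) s_μ(q^{-h}, …, q^h) z^h`.

Schur polynomials are handled through Gelfand–Tsetlin patterns, that is, by peeling off the
horizontal strip filled with the largest letter (`aeval_schur`). This gives two things. First, the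
symmetry of Schur polynomials (`gtSum_perm`), by the Bender–Knuth involution, which reflects each
part of an intermediate partition in the interval in which it may vary; it is needed because the
enumeration of monomials in a plethysm is arbitrary. Second, a recursion for the principal
specialization, which shows (`isQExp_gtSum`) that `s_μ(1, t, …, t^{N-1}) = ∑_{j ≤ w} c_j t^{jN}`
with `c_j (t; t)_j (t; t)_{w-j}` a polynomial. Since Gaussian binomial coefficients are polynomials,
`(q - q⁻¹) s_μ[s_h](q, q⁻¹) = ∑_{j ≤ w} γ_j q^{(2j-w)h}` with formal Laurent series `γ_j` in `q` for
which `γ_j (q²; q²)_w` is a Laurent polynomial (`exists_expansion`).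

The positive part is now taken for each `j` separately, inside formal Laurent series. Put
`a = 2j - w`.
* If `a > 0`, almost all exponents in `∑ h, γ_j q^{ah} z^h` are positive, and the factor `1 - q^a z`
  of `d_w` clears the denominator (`zBounded_of_pos`).
* If `a = 0`, the factor `1 - z` does.
* If `a = -b < 0`, let `p(z)` be the part `∏ (1 - z^i)` or `∏ (1 - z^{2i})` of `d_w`. Multiplication
  by `p(z)` commutes with taking the positive part and multiplies `γ_j` by `p(q^b)`, up to finitely
  many powers of `z`. As `(q²; q²)_w` divides `p(q^b)`, the product `γ_j p(q^b)` is a Laurent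
  polynomial, so `γ_j p(q^b) q^{-bh}` has no positive part for large `h` (`zBounded_of_neg`).

Hence `d_w A_μ` has bounded degree in `z`, and since each coefficient of `z^h` is a polynomial in
`q`, it is a polynomial.
-/

namespace SL2Plethysm

/-! ### Gelfand–Tsetlin sums and their symmetry -/

section

open Finset

/-- The partition `(λ₁, λ₂, …)` obtained from `λ = (λ₀, λ₁, …)` by deleting its first part. -/
noncomputable def tail (lam : ℕ →₀ ℕ) : ℕ →₀ ℕ :=
  lam.comapDomain (· + 1) (add_left_injective 1).injOn

@[simp]
theorem tail_apply (lam : ℕ →₀ ℕ) (i : ℕ) : tail lam i = lam (i + 1) := rfl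

theorem mem_interlace {lam κ : ℕ →₀ ℕ} :
    κ ∈ Icc (tail lam) lam ↔ ∀ i, lam (i + 1) ≤ κ i ∧ κ i ≤ lam i := by
  rw [mem_Icc, Finsupp.le_def, Finsupp.le_def]
  exact ⟨fun h i => ⟨h.1 i, h.2 i⟩, fun h => ⟨fun i => (h i).1, fun i => (h i).2⟩⟩

theorem degree_le_of_mem_interlace {lam κ : ℕ →₀ ℕ} (h : κ ∈ Icc (tail lam) lam) :
    κ.degree ≤ lam.degree :=
  Finsupp.degree_mono (mem_Icc.1 h).2

theorem degree_eq_sum_range {lam : ℕ →₀ ℕ} {M : ℕ} (h : ∀ i, M ≤ i → lam i = 0) :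
    lam.degree = ∑ i ∈ range M, lam i := by
  rw [Finsupp.degree_apply]
  refine sum_subset (fun i hi => ?_) (fun i _ hi => by simpa using hi)
  by_contra hM
  exact (Finsupp.mem_support_iff.1 hi) (h i (by simpa using hM))

theorem exists_forall_ge_eq_zero (lam : ℕ →₀ ℕ) : ∃ M, ∀ i, M ≤ i → lam i = 0 := by
  refine ⟨lam.support.sup id + 1, fun i hi => ?_⟩
  by_contra h
  have : i ≤ lam.support.sup id := le_sup (f := id) (Finsupp.mem_support_iff.2 h)
  omega

variable {R : Type*} [CommSemiring R]

/-- The Schur polynomial `s_λ`, evaluated at `x_0, …, x_{N-1}`, as a sum over Gelfand–Tsetlin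
patterns: peel off the horizontal strip `λ / κ` filled with the largest letter. -/
noncomputable def gtSum (x : ℕ → R) : ℕ → (ℕ →₀ ℕ) → R
  | 0, lam => if lam = 0 then 1 else 0
  | N + 1, lam => ∑ κ ∈ Icc (tail lam) lam, x N ^ (lam.degree - κ.degree) * gtSum x N κ

theorem gtSum_congr {x y : ℕ → R} {N : ℕ} (h : ∀ i < N, x i = y i) (lam : ℕ →₀ ℕ) :
    gtSum x N lam = gtSum y N lam := by
  induction N generalizing lam with
  | zero => rfl
  | succ N ih =>
    simp only [gtSum]
    refine sum_congr rfl fun κ _ => ?_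
    rw [h N (Nat.lt_succ_self N), ih fun i hi => h i (Nat.lt_succ_of_lt hi)]

theorem gtSum_const_mul (c : R) (x : ℕ → R) (N : ℕ) (lam : ℕ →₀ ℕ) :
    gtSum (fun i => c * x i) N lam = c ^ lam.degree * gtSum x N lam := by
  induction N generalizing lam with
  | zero =>
    simp only [gtSum]
    split_ifs with h
    · simp [h]
    · simp
  | succ N ih =>
    simp only [gtSum, mul_sum]
    refine sum_congr rfl fun κ hκ => ?_
    have h := degree_le_of_mem_interlace hκ
    rw [ih, mul_pow]
    conv_rhs => rw [← Nat.sub_add_cancel h, pow_add, Nat.sub_add_cancel h]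
    ring

theorem map_gtSum {S : Type*} [CommSemiring S] (f : R →+* S) (x : ℕ → R) (N : ℕ)
    (lam : ℕ →₀ ℕ) : f (gtSum x N lam) = gtSum (fun i => f (x i)) N lam := by
  induction N generalizing lam with
  | zero => simp only [gtSum]; split_ifs <;> simp
  | succ N ih => simp [gtSum, ih]

/-- The upper end of the interval in which `κ i` moves when `κ` interlaces with both `λ` and `ν`;
the lower end is `max (λ_{i+1}) (ν_i)`. -/
def upperEnd (lam nu : ℕ →₀ ℕ) : ℕ → ℕ
  | 0 => lam 0
  | i + 1 => min (lam (i + 1)) (nu i)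

theorem upperEnd_le (lam nu : ℕ →₀ ℕ) (i : ℕ) : upperEnd lam nu i ≤ lam i := by
  cases i <;> simp [upperEnd]

/-- The partition obtained from `κ` by reflecting each `κ i` in the interval in which it moves when
it interlaces with both `λ` and `ν`. -/
noncomputable def reflect (lam nu κ : ℕ →₀ ℕ) : ℕ →₀ ℕ :=
  Finsupp.onFinset lam.support
    (fun i => if lam i = 0 then 0 else max (lam (i + 1)) (nu i) + upperEnd lam nu i - κ i)
    (fun i h => by
      rw [Finsupp.mem_support_iff]
      exact fun h0 => h (if_pos h0))

theorem mem_interlace_interlace {lam nu κ : ℕ →₀ ℕ} :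
    (κ ∈ Icc (tail lam) lam ∧ nu ∈ Icc (tail κ) κ) ↔
      ∀ i, max (lam (i + 1)) (nu i) ≤ κ i ∧ κ i ≤ upperEnd lam nu i := by
  rw [mem_interlace, mem_interlace]
  constructor
  · rintro ⟨h1, h2⟩ i
    have a := h1 i
    have b := h2 i
    cases i with
    | zero => simp only [upperEnd]; omega
    | succ i =>
      have c := h2 i
      simp only [upperEnd]; omega
  · intro h
    constructor
    · intro i
      have a := h i
      have b := upperEnd_le lam nu i
      omega
    · intro i
      have a := h i
      have b := h (i + 1)
      simp only [upperEnd] at b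
      omega

theorem reflect_apply {lam nu κ : ℕ →₀ ℕ} (h1 : κ ∈ Icc (tail lam) lam)
    (h2 : nu ∈ Icc (tail κ) κ) (i : ℕ) :
    reflect lam nu κ i = max (lam (i + 1)) (nu i) + upperEnd lam nu i - κ i := by
  have h := mem_interlace_interlace.1 ⟨h1, h2⟩ i
  have b := upperEnd_le lam nu i
  simp only [reflect, Finsupp.onFinset_apply]
  split_ifs <;> omega

theorem reflect_mem {lam nu κ : ℕ →₀ ℕ} (h1 : κ ∈ Icc (tail lam) lam)
    (h2 : nu ∈ Icc (tail κ) κ) :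
    reflect lam nu κ ∈ Icc (tail lam) lam ∧ nu ∈ Icc (tail (reflect lam nu κ))
      (reflect lam nu κ) := by
  rw [mem_interlace_interlace]
  intro i
  have h := mem_interlace_interlace.1 ⟨h1, h2⟩ i
  rw [reflect_apply h1 h2]
  omega

theorem reflect_reflect {lam nu κ : ℕ →₀ ℕ} (h1 : κ ∈ Icc (tail lam) lam)
    (h2 : nu ∈ Icc (tail κ) κ) : reflect lam nu (reflect lam nu κ) = κ := by
  ext i
  have h := mem_interlace_interlace.1 ⟨h1, h2⟩ i
  rw [reflect_apply (reflect_mem h1 h2).1 (reflect_mem h1 h2).2, reflect_apply h1 h2]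
  omega

/-- Reflecting swaps the sizes of the two horizontal strips `λ / κ` and `κ / ν`. This holds because
`max (λ_{i+1}) (ν_i) + min (λ_{i+1}) (ν_i) = λ_{i+1} + ν_i`. -/
theorem degree_reflect_add {lam nu κ : ℕ →₀ ℕ} (h1 : κ ∈ Icc (tail lam) lam)
    (h2 : nu ∈ Icc (tail κ) κ) :
    (reflect lam nu κ).degree + κ.degree = lam.degree + nu.degree := by
  obtain ⟨M, hM⟩ := exists_forall_ge_eq_zero lam
  have hκ : ∀ i, M ≤ i → κ i = 0 := fun i hi => by
    have := (mem_interlace.1 h1 i).2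
    have := hM i hi
    omega
  have hnu : ∀ i, M ≤ i → nu i = 0 := fun i hi => by
    have := (mem_interlace.1 h2 i).2
    have := hκ i hi
    omega
  have hr : ∀ i, M ≤ i → reflect lam nu κ i = 0 := fun i hi => by
    have := (mem_interlace.1 (reflect_mem h1 h2).1 i).2
    have := hM i hi
    omega
  have hM' : ∀ {l : ℕ →₀ ℕ}, (∀ i, M ≤ i → l i = 0) → ∀ i, M + 1 ≤ i → l i = 0 :=
    fun h i hi => h i (by omega)
  rw [degree_eq_sum_range (hM' hr), degree_eq_sum_range (hM' hκ), degree_eq_sum_range (hM' hM),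
    degree_eq_sum_range (hM' hnu), ← sum_add_distrib]
  have h : ∀ i, reflect lam nu κ i + κ i = max (lam (i + 1)) (nu i) + upperEnd lam nu i := by
    intro i
    have h := mem_interlace_interlace.1 ⟨h1, h2⟩ i
    rw [reflect_apply h1 h2]
    omega
  rw [sum_congr rfl fun i _ => h i, sum_add_distrib, sum_range_succ, sum_range_succ' (upperEnd _ _),
    sum_range_succ' lam, sum_range_succ nu, hM (M + 1) (by omega), hnu M le_rfl]
  simp only [upperEnd, max_self, add_zero]
  have : ∑ i ∈ range M, max (lam (i + 1)) (nu i) + ∑ i ∈ range M, min (lam (i + 1)) (nu i) =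
      ∑ i ∈ range M, lam (i + 1) + ∑ i ∈ range M, nu i := by
    rw [← sum_add_distrib, ← sum_add_distrib]
    exact sum_congr rfl fun i _ => max_add_min _ _
  omega

/-- The Bender–Knuth involution: adding two horizontal strips in succession is symmetric in the
two letters. -/
theorem sum_interlace_comm (a b : R) (g : (ℕ →₀ ℕ) → R) (lam : ℕ →₀ ℕ) :
    ∑ κ ∈ Icc (tail lam) lam, a ^ (lam.degree - κ.degree) *
        ∑ nu ∈ Icc (tail κ) κ, b ^ (κ.degree - nu.degree) * g nu =
      ∑ κ ∈ Icc (tail lam) lam, b ^ (lam.degree - κ.degree) *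
        ∑ nu ∈ Icc (tail κ) κ, a ^ (κ.degree - nu.degree) * g nu := by
  simp only [mul_sum]
  rw [sum_sigma', sum_sigma']
  have hmem : ∀ p ∈ (Icc (tail lam) lam).sigma fun κ => Icc (tail κ) κ,
      (⟨reflect lam p.2 p.1, p.2⟩ : (_ : ℕ →₀ ℕ) × (ℕ →₀ ℕ)) ∈
        (Icc (tail lam) lam).sigma fun κ => Icc (tail κ) κ := by
    intro p hp
    rw [mem_sigma] at hp ⊢
    exact reflect_mem hp.1 hp.2
  have hinv : ∀ p ∈ (Icc (tail lam) lam).sigma fun κ => Icc (tail κ) κ,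
      (⟨reflect lam p.2 (reflect lam p.2 p.1), p.2⟩ : (_ : ℕ →₀ ℕ) × (ℕ →₀ ℕ)) = p := by
    intro p hp
    rw [mem_sigma] at hp
    rw [reflect_reflect hp.1 hp.2]
  refine sum_nbij' (fun p => ⟨reflect lam p.2 p.1, p.2⟩) (fun p => ⟨reflect lam p.2 p.1, p.2⟩)
    hmem hmem hinv hinv ?_
  intro p hp
  rw [mem_sigma] at hp
  have h := degree_reflect_add hp.1 hp.2
  have h1 := degree_le_of_mem_interlace hp.1
  have h2 := degree_le_of_mem_interlace hp.2
  have e1 : lam.degree - (reflect lam p.2 p.1).degree = p.1.degree - p.2.degree := by omega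
  have e2 : (reflect lam p.2 p.1).degree - p.2.degree = lam.degree - p.1.degree := by omega
  simp only [e1, e2]
  ring

theorem gtSum_swap (x : ℕ → R) (k : ℕ) {N : ℕ} (hk : k + 1 < N) (lam : ℕ →₀ ℕ) :
    gtSum (fun i => x (Equiv.swap k (k + 1) i)) N lam = gtSum x N lam := by
  induction N generalizing lam with
  | zero => omega
  | succ N ih =>
    rcases Nat.lt_or_ge (k + 1) N with h | h
    · simp only [gtSum]
      refine sum_congr rfl fun κ _ => ?_
      rw [ih h, Equiv.swap_apply_of_ne_of_ne (by omega) (by omega)]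
    · obtain rfl : N = k + 1 := by omega
      simp only [gtSum, Equiv.swap_apply_left, Equiv.swap_apply_right]
      have e : ∀ nu, gtSum (fun i => x (Equiv.swap k (k + 1) i)) k nu = gtSum x k nu := fun nu =>
        gtSum_congr (fun i hi => by
          rw [Equiv.swap_apply_of_ne_of_ne (by omega) (by omega)]) nu
      simp only [e]
      exact sum_interlace_comm (x k) (x (k + 1)) (gtSum x k) lam

/-- Extend a finite sequence by zero. -/
def extendZero {N : ℕ} (y : Fin N → R) (i : ℕ) : R := if h : i < N then y ⟨i, h⟩ else 0

/-- Schur polynomials are symmetric. -/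
theorem gtSum_perm {N : ℕ} (y : Fin N → R) (σ : Equiv.Perm (Fin N)) (lam : ℕ →₀ ℕ) :
    gtSum (extendZero (y ∘ σ)) N lam = gtSum (extendZero y) N lam := by
  cases N with
  | zero => exact gtSum_congr (fun i hi => by omega) lam
  | succ n =>
    have hσ : σ ∈ Submonoid.closure
        (Set.range fun i : Fin n => Equiv.swap i.castSucc i.succ) := by
      rw [Equiv.Perm.mclosure_swap_castSucc_succ]; trivial
    induction hσ using Submonoid.closure_induction generalizing y with
    | mem s hs =>
      obtain ⟨k, rfl⟩ := hs
      rw [← gtSum_swap (extendZero y) k (N := n + 1) (by omega)]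
      refine gtSum_congr (fun i hi => ?_) lam
      have hlt : Equiv.swap (k : ℕ) (k + 1) i < n + 1 := by
        rw [Equiv.swap_apply_def]; split_ifs <;> omega
      simp only [extendZero, dif_pos hi, dif_pos hlt, Function.comp]
      congr 1
      ext
      simp only [Equiv.swap_apply_def, Fin.ext_iff, Fin.val_castSucc, Fin.val_succ]
      split_ifs <;> simp
    | one => rfl
    | mul s t _ _ hs ht =>
      rw [show y ∘ (s * t : Equiv.Perm (Fin (n + 1))) = (y ∘ s) ∘ t from rfl, ht, hs]

end

/-! ### Semistandard tableaux and Gelfand–Tsetlin sums -/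

section

open Finset

variable {R : Type*} [CommSemiring R]

/-- Semistandard fillings with entries `< N` of the shape with row lengths `λ`, extended by zero
outside of the shape. Only neighbouring cells are compared, which suffices if `λ` is a partition. -/
def IsTableau (N : ℕ) (lam : ℕ →₀ ℕ) (T : ℕ → ℕ → ℕ) : Prop :=
  ∀ i j, (j < lam i → T i j < N) ∧ (lam i ≤ j → T i j = 0) ∧
    (j + 1 < lam i → T i j ≤ T i (j + 1)) ∧ (j < lam (i + 1) → T i j < T (i + 1) j)

/-- The monomial of a filling. -/
noncomputable def tabWeight (x : ℕ → R) (lam : ℕ →₀ ℕ) (T : ℕ → ℕ → ℕ) : R :=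
  ∏ i ∈ lam.support, ∏ j ∈ range (lam i), x (T i j)

theorem tabWeight_eq_prod_range (x : ℕ → R) {lam : ℕ →₀ ℕ} {M : ℕ} (h : ∀ i, M ≤ i → lam i = 0)
    (T : ℕ → ℕ → ℕ) : tabWeight x lam T = ∏ i ∈ range M, ∏ j ∈ range (lam i), x (T i j) := by
  refine prod_subset (fun i hi => ?_) (fun i _ hi => ?_)
  · by_contra hM
    exact (Finsupp.mem_support_iff.1 hi) (h i (by simpa using hM))
  · rw [Finsupp.notMem_support_iff.1 hi]; simp

theorem IsTableau.row_weak {N : ℕ} {lam : ℕ →₀ ℕ} {T : ℕ → ℕ → ℕ} (hT : IsTableau N lam T)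
    {i j j' : ℕ} (h : j ≤ j') (hj : j' < lam i) : T i j ≤ T i j' := by
  induction j', h using Nat.le_induction with
  | base => exact le_rfl
  | succ k hk ih => exact (ih (by omega)).trans ((hT i k).2.2.1 hj)

/-- The row lengths of the part of a filling `T` with entries `< N`. -/
noncomputable def innerShape (N : ℕ) (lam : ℕ →₀ ℕ) (T : ℕ → ℕ → ℕ) : ℕ →₀ ℕ :=
  Finsupp.onFinset lam.support (fun i => Nat.count (fun j => T i j < N) (lam i)) (fun i h => by
    rw [Finsupp.mem_support_iff]
    intro h0
    rw [h0] at h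
    exact h (Nat.count_zero _))

/-- Remove all entries of a filling outside the shape with row lengths `κ`. -/
def restrict (κ : ℕ →₀ ℕ) (T : ℕ → ℕ → ℕ) (i j : ℕ) : ℕ := if j < κ i then T i j else 0

/-- Fill the strip `λ / κ` with the letter `N`. -/
def extend (N : ℕ) (lam κ : ℕ →₀ ℕ) (T : ℕ → ℕ → ℕ) (i j : ℕ) : ℕ :=
  if j < κ i then T i j else if j < lam i then N else 0

/-- Counting a downward closed predicate. -/
theorem lt_count_iff (p : ℕ → Prop) [DecidablePred p] (n : ℕ)
    (hp : ∀ i j, i ≤ j → j < n → p j → p i) (j : ℕ) : j < Nat.count p n ↔ j < n ∧ p j := by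
  induction n with
  | zero => simp
  | succ n ih =>
    have ih' := ih fun i j hij hj => hp i j hij (by omega)
    by_cases hn : p n
    · have hall : ∀ i, i < n + 1 → p i := fun i hi => hp i n (by omega) (by omega) hn
      rw [Nat.count_iff_forall.2 fun {i} hi => hall i hi]
      exact ⟨fun h => ⟨h, hall j h⟩, fun h => h.1⟩
    · rw [Nat.count_succ, if_neg hn, add_zero, ih']
      constructor
      · rintro ⟨h1, h2⟩
        exact ⟨by omega, h2⟩
      · rintro ⟨h1, h2⟩
        refine ⟨?_, h2⟩
        rcases Nat.lt_succ_iff_lt_or_eq.1 h1 with h | rfl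
        · exact h
        · exact absurd h2 hn

theorem IsTableau.lt_innerShape_iff {N : ℕ} {lam : ℕ →₀ ℕ} {T : ℕ → ℕ → ℕ}
    (hT : IsTableau (N + 1) lam T) (i j : ℕ) :
    j < innerShape N lam T i ↔ j < lam i ∧ T i j < N := by
  refine lt_count_iff (fun j => T i j < N) (lam i) (fun a b hab hb h => ?_) j
  exact (hT.row_weak hab hb).trans_lt h

theorem IsTableau.innerShape_mem {N : ℕ} {lam : ℕ →₀ ℕ} {T : ℕ → ℕ → ℕ}
    (hlam : ∀ i, lam (i + 1) ≤ lam i) (hT : IsTableau (N + 1) lam T) :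
    innerShape N lam T ∈ Icc (tail lam) lam := by
  rw [mem_interlace]
  intro i
  constructor
  · by_contra h
    have h' : innerShape N lam T i < lam (i + 1) := by omega
    have h1 := (hT i _).2.2.2 h'
    have h2 := (hT (i + 1) _).1 h'
    exact lt_irrefl _ ((hT.lt_innerShape_iff i _).2 ⟨h'.trans_le (hlam i), by omega⟩)
  · by_contra h
    have := (hT.lt_innerShape_iff i (lam i)).1 (by omega)
    omega

theorem IsTableau.restrict {N : ℕ} {lam : ℕ →₀ ℕ} {T : ℕ → ℕ → ℕ}
    (hT : IsTableau (N + 1) lam T) :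
    IsTableau N (innerShape N lam T) (restrict (innerShape N lam T) T) := by
  have key := hT.lt_innerShape_iff
  intro i j
  have hij := hT i j
  have k1 := key i j
  have k2 := key (i + 1) j
  have k3 := key i (j + 1)
  simp only [SL2Plethysm.restrict]
  refine ⟨fun h => ?_, fun h => ?_, fun h => ?_, fun h => ?_⟩
  · rw [if_pos h]; exact (k1.1 h).2
  · rw [if_neg (by omega)]
  · rw [if_pos h, if_pos (by omega)]; exact hij.2.2.1 (k3.1 h).1
  · have h2 := k2.1 h
    have h3 := hij.2.2.2 h2.1
    rw [if_pos h]
    split_ifs with h4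
    · exact h3
    · omega

theorem IsTableau.extend {N : ℕ} {lam κ : ℕ →₀ ℕ} {T : ℕ → ℕ → ℕ}
    (hκ : κ ∈ Icc (tail lam) lam) (hT : IsTableau N κ T) :
    IsTableau (N + 1) lam (extend N lam κ T) := by
  rw [mem_interlace] at hκ
  intro i j
  have hij := hT i j
  have hij' := hT i (j + 1)
  have hi := hκ i
  have hi' := hκ (i + 1)
  simp only [SL2Plethysm.extend]
  refine ⟨fun h => ?_, fun h => ?_, fun h => ?_, fun h => ?_⟩
  · split_ifs with h1
    · have := hij.1 h1; omega
    · omega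
  · rw [if_neg (by omega), if_neg (by omega)]
  · rw [if_pos h, if_pos (show j < lam i by omega)]
    split_ifs with h1 h2 h2
    · exact hij.2.2.1 h2
    · exact (hij.1 h1).le
    · omega
    · exact le_rfl
  · rw [if_pos h, if_pos (show j < κ i by omega)]
    split_ifs with h1
    · exact hij.2.2.2 h1
    · exact hij.1 (by omega)

theorem innerShape_extend {N : ℕ} {lam κ : ℕ →₀ ℕ} {T : ℕ → ℕ → ℕ}
    (hκ : κ ∈ Icc (tail lam) lam) (hT : IsTableau N κ T) :
    innerShape N lam (extend N lam κ T) = κ := by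
  have key := (hT.extend hκ).lt_innerShape_iff
  rw [mem_interlace] at hκ
  ext i
  refine eq_of_forall_lt_iff fun j => ?_
  rw [key i j]
  have hij := hT i j
  have hi := hκ i
  simp only [extend]
  constructor
  · rintro ⟨h1, h2⟩
    by_contra h3
    rw [if_neg h3, if_pos h1] at h2
    omega
  · intro h
    rw [if_pos h]
    exact ⟨by omega, hij.1 h⟩

theorem restrict_extend {N : ℕ} {lam κ : ℕ →₀ ℕ} {T : ℕ → ℕ → ℕ} (hT : IsTableau N κ T) :
    restrict κ (extend N lam κ T) = T := by
  funext i j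
  have hij := hT i j
  simp only [extend, restrict]
  split_ifs with h
  · rfl
  · rw [hij.2.1 (by omega)]

theorem IsTableau.extend_restrict {N : ℕ} {lam : ℕ →₀ ℕ} {T : ℕ → ℕ → ℕ}
    (hT : IsTableau (N + 1) lam T) :
    SL2Plethysm.extend N lam (innerShape N lam T) (SL2Plethysm.restrict (innerShape N lam T) T) =
      T := by
  funext i j
  have k1 := hT.lt_innerShape_iff i j
  have hij := hT i j
  simp only [SL2Plethysm.extend, SL2Plethysm.restrict]
  split_ifs with h1 h2
  · rfl
  · have := hij.1 h2
    by_contra h3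
    exact h1 (k1.2 ⟨h2, by omega⟩)
  · rw [hij.2.1 (by omega)]

theorem tabWeight_extend (x : ℕ → R) {N : ℕ} {lam κ : ℕ →₀ ℕ} (T : ℕ → ℕ → ℕ)
    (hκ : κ ∈ Icc (tail lam) lam) :
    tabWeight x lam (extend N lam κ T) =
      x N ^ (lam.degree - κ.degree) * tabWeight x κ T := by
  have hle := degree_le_of_mem_interlace hκ
  rw [mem_interlace] at hκ
  obtain ⟨M, hM⟩ := exists_forall_ge_eq_zero lam
  have hκM : ∀ i, M ≤ i → κ i = 0 := fun i hi => by
    have := (hκ i).2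
    have := hM i hi
    omega
  rw [tabWeight_eq_prod_range x hM, tabWeight_eq_prod_range x hκM]
  have h : lam.degree - κ.degree = ∑ i ∈ range M, (lam i - κ i) := by
    rw [degree_eq_sum_range hM, degree_eq_sum_range hκM, sum_tsub_distrib _ fun i _ => (hκ i).2]
  rw [h, ← prod_pow_eq_pow_sum, ← prod_mul_distrib]
  refine prod_congr rfl fun i _ => ?_
  have hi := (hκ i).2
  conv_lhs => rw [← Nat.add_sub_cancel' hi, prod_range_add]
  rw [mul_comm]
  congr 1
  · rw [prod_eq_pow_card (b := x N) (fun j hj => ?_), card_range]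
    have := mem_range.1 hj
    rw [extend, if_neg (by omega), if_pos (by omega)]
  · refine prod_congr rfl fun j hj => ?_
    rw [extend, if_pos (mem_range.1 hj)]

/-- Removing the largest letter identifies the fillings of `λ` in `N + 1` letters with pairs of a
partition `κ` interlacing with `λ` and a filling of `κ` in `N` letters. -/
noncomputable def tableauEquiv (N : ℕ) (lam : ℕ →₀ ℕ) (hlam : ∀ i, lam (i + 1) ≤ lam i) :
    {T // IsTableau (N + 1) lam T} ≃
      Σ κ : {κ // κ ∈ Icc (tail lam) lam}, {T // IsTableau N κ.1 T} where
  toFun T := ⟨⟨innerShape N lam T.1, T.2.innerShape_mem hlam⟩, ⟨_, T.2.restrict⟩⟩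
  invFun p := ⟨extend N lam p.1.1 p.2.1, p.2.2.extend p.1.2⟩
  left_inv T := Subtype.ext T.2.extend_restrict
  right_inv p := by
    obtain ⟨⟨κ, hκ⟩, ⟨T, hT⟩⟩ := p
    have h := innerShape_extend hκ hT
    have h' := restrict_extend (lam := lam) hT
    refine Sigma.ext (Subtype.ext h) ?_
    simp only
    refine (Subtype.heq_iff_coe_eq fun T => by rw [h]).2 ?_
    simp only [h]
    exact h'

theorem isTableau_zero_iff {lam : ℕ →₀ ℕ} {T : ℕ → ℕ → ℕ} :
    IsTableau 0 lam T ↔ lam = 0 ∧ T = 0 := by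
  constructor
  · intro h
    have h0 : lam = 0 := by
      ext i
      by_contra hi
      exact absurd ((h i 0).1 (Nat.pos_of_ne_zero hi)) (by omega)
    refine ⟨h0, ?_⟩
    funext i j
    exact (h i j).2.1 (by simp [h0])
  · rintro ⟨rfl, rfl⟩ i j
    simp

theorem finite_isTableau (N : ℕ) (lam : ℕ →₀ ℕ) (hlam : ∀ i, lam (i + 1) ≤ lam i) :
    Finite {T // IsTableau N lam T} := by
  induction N generalizing lam with
  | zero =>
    have : Subsingleton {T // IsTableau 0 lam T} :=
      ⟨fun a b => Subtype.ext
        ((isTableau_zero_iff.1 a.2).2.trans (isTableau_zero_iff.1 b.2).2.symm)⟩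
    infer_instance
  | succ N ih =>
    have : ∀ κ : {κ // κ ∈ Icc (tail lam) lam}, Finite {T // IsTableau N κ.1 T} := fun κ =>
      ih κ.1 fun i => ((mem_interlace.1 κ.2 (i + 1)).2).trans (mem_interlace.1 κ.2 i).1
    exact Finite.of_equiv _ (tableauEquiv N lam hlam).symm

theorem sum_tabWeight (x : ℕ → R) (N : ℕ) (lam : ℕ →₀ ℕ) (hlam : ∀ i, lam (i + 1) ≤ lam i)
    [Fintype {T // IsTableau N lam T}] :
    ∑ T : {T // IsTableau N lam T}, tabWeight x lam T.1 = gtSum x N lam := by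
  induction N generalizing lam with
  | zero =>
    rw [gtSum]
    split_ifs with h
    · subst h
      have : Unique {T // IsTableau 0 0 T} :=
        { default := ⟨0, isTableau_zero_iff.2 ⟨rfl, rfl⟩⟩
          uniq := fun a => Subtype.ext (isTableau_zero_iff.1 a.2).2 }
      rw [Fintype.sum_unique]
      simp [tabWeight]
    · have : IsEmpty {T // IsTableau 0 lam T} := ⟨fun a => h (isTableau_zero_iff.1 a.2).1⟩
      exact Fintype.sum_empty _
  | succ N ih =>
    have hκ : ∀ κ : {κ // κ ∈ Icc (tail lam) lam}, ∀ i, κ.1 (i + 1) ≤ κ.1 i := fun κ i =>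
      ((mem_interlace.1 κ.2 (i + 1)).2).trans (mem_interlace.1 κ.2 i).1
    have (κ : {κ // κ ∈ Icc (tail lam) lam}) : Finite {T // IsTableau N κ.1 T} :=
      finite_isTableau N κ.1 (hκ κ)
    let (κ : {κ // κ ∈ Icc (tail lam) lam}) : Fintype {T // IsTableau N κ.1 T} :=
      Fintype.ofFinite _
    rw [gtSum, ← sum_coe_sort (Icc (tail lam) lam)
      (fun κ => x N ^ (lam.degree - κ.degree) * gtSum x N κ),
      ← (tableauEquiv N lam hlam).symm.sum_comp, Fintype.sum_sigma]
    refine Fintype.sum_congr _ _ fun κ => ?_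
    rw [← ih κ.1 (hκ κ), mul_sum]
    exact Fintype.sum_congr _ _ fun T => tabWeight_extend x T.1 κ.2

/-- The row lengths of a Young diagram. -/
noncomputable def rowFinsupp (μ : YoungDiagram) : ℕ →₀ ℕ :=
  Finsupp.onFinset (range (μ.colLen 0)) μ.rowLen (fun i h => by
    rw [mem_range, ← YoungDiagram.mem_iff_lt_colLen, YoungDiagram.mem_iff_lt_rowLen]
    omega)

@[simp]
theorem rowFinsupp_apply (μ : YoungDiagram) (i : ℕ) : rowFinsupp μ i = μ.rowLen i := rfl

theorem rowFinsupp_succ_le (μ : YoungDiagram) (i : ℕ) :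
    rowFinsupp μ (i + 1) ≤ rowFinsupp μ i :=
  μ.rowLen_anti i (i + 1) (Nat.le_succ i)

theorem prod_cells {M : Type*} [CommMonoid M] (μ : YoungDiagram) (f : ℕ × ℕ → M) :
    ∏ c ∈ μ.cells, f c = ∏ i ∈ (rowFinsupp μ).support, ∏ j ∈ range (μ.rowLen i), f (i, j) := by
  rw [prod_sigma']
  refine prod_nbij' (fun c => ⟨c.1, c.2⟩) (fun p => (p.1, p.2)) ?_ ?_ ?_ ?_ ?_
  · rintro ⟨i, j⟩ h
    have := YoungDiagram.mem_iff_lt_rowLen.1 ((μ.mem_cells _).1 h)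
    simp only [mem_sigma, Finsupp.mem_support_iff, rowFinsupp_apply, mem_range]
    omega
  · rintro ⟨i, j⟩ h
    simp only [mem_sigma, mem_range] at h
    exact (μ.mem_cells _).2 (YoungDiagram.mem_iff_lt_rowLen.2 h.2)
  · intros; rfl
  · intros; rfl
  · intros; rfl

theorem degree_rowFinsupp (μ : YoungDiagram) : (rowFinsupp μ).degree = μ.card := by
  rw [YoungDiagram.card, card_eq_sum_ones, Finsupp.degree_apply]
  have h := prod_cells μ (fun _ => Multiplicative.ofAdd 1)
  have h' : ∑ c ∈ μ.cells, 1 = ∑ i ∈ (rowFinsupp μ).support, ∑ j ∈ range (μ.rowLen i), 1 := h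
  rw [h']
  simp

theorem isTableau_of_ssyt {N : ℕ} {μ : YoungDiagram} (T : SSYT N μ) :
    IsTableau N (rowFinsupp μ) (fun i j => T.1 i j) := by
  intro i j
  simp only [rowFinsupp_apply, ← YoungDiagram.mem_iff_lt_rowLen]
  refine ⟨fun h => T.2 (i, j) ((μ.mem_cells _).2 h), fun h => T.1.zeros ?_, fun h => ?_,
    fun h => ?_⟩
  · rw [YoungDiagram.mem_iff_lt_rowLen]
    omega
  · exact T.1.row_weak (Nat.lt_succ_self j) h
  · exact T.1.col_strict (Nat.lt_succ_self i) h

/-- The tableau with a given filling. -/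
def ssytOfIsTableau {N : ℕ} {μ : YoungDiagram} {T : ℕ → ℕ → ℕ}
    (hT : IsTableau N (rowFinsupp μ) T) : SSYT N μ where
  val :=
    { entry := T
      row_weak' := fun hj h => hT.row_weak hj.le (YoungDiagram.mem_iff_lt_rowLen.1 h)
      col_strict' := fun {i1 i2 j} hi h => by
        induction i2, hi using Nat.le_induction with
        | base => exact (hT i1 j).2.2.2 (YoungDiagram.mem_iff_lt_rowLen.1 h)
        | succ k hk ih =>
          exact (ih (μ.up_left_mem (Nat.le_succ k) le_rfl h)).trans
            ((hT k j).2.2.2 (YoungDiagram.mem_iff_lt_rowLen.1 h))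
      zeros' := fun {i j} h => (hT i j).2.1 (by
        rw [YoungDiagram.mem_iff_lt_rowLen] at h
        simpa using h) }
  property := fun c hc => (hT c.1 c.2).1
    (YoungDiagram.mem_iff_lt_rowLen.1 ((μ.mem_cells _).1 hc))

/-- Semistandard tableaux are determined by their fillings. -/
noncomputable def ssytEquiv (N : ℕ) (μ : YoungDiagram) :
    SSYT N μ ≃ {T // IsTableau N (rowFinsupp μ) T} where
  toFun T := ⟨_, isTableau_of_ssyt T⟩
  invFun T := ssytOfIsTableau T.2
  left_inv _ := rfl
  right_inv _ := rfl

/-- Schur polynomials, evaluated at arbitrary elements, in terms of Gelfand–Tsetlin patterns. -/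
theorem aeval_schur {S : Type*} [CommRing S] [Algebra ℤ S] {N : ℕ} (y : Fin N → S)
    (μ : YoungDiagram) :
    MvPolynomial.aeval y (schur N μ) = gtSum (extendZero y) N (rowFinsupp μ) := by
  have := finite_isTableau N (rowFinsupp μ) (rowFinsupp_succ_le μ)
  let _ : Fintype {T // IsTableau N (rowFinsupp μ) T} := Fintype.ofFinite _
  rw [← sum_tabWeight _ _ _ (rowFinsupp_succ_le μ), schur, map_sum,
    ← (ssytEquiv N μ).sum_comp]
  refine Fintype.sum_congr _ _ fun T => ?_
  rw [SSYT.monomial, map_prod]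
  simp only [MvPolynomial.aeval_X]
  have h := prod_cells μ (fun c => extendZero y (T.1 c.1 c.2))
  rw [← prod_attach] at h
  exact (prod_congr rfl fun c _ => by rw [extendZero, dif_pos (T.2 c.1 c.2)]).trans h

end

/-! ### Principal specializations -/

section

open Finset

/-- The product `(1 - t)(1 - t²)⋯(1 - tⁿ)`. -/
def qPoch {R : Type*} [CommRing R] (t : R) (n : ℕ) : R := ∏ i ∈ range n, (1 - t ^ (i + 1))

section qPoch

variable {R : Type*} [CommRing R] (t : R)

@[simp]
theorem qPoch_zero : qPoch t 0 = 1 := by simp [qPoch]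

theorem qPoch_succ (n : ℕ) : qPoch t (n + 1) = qPoch t n * (1 - t ^ (n + 1)) := by
  rw [qPoch, prod_range_succ, qPoch]

theorem map_qPoch {S : Type*} [CommRing S] (f : R →+* S) (n : ℕ) :
    f (qPoch t n) = qPoch (f t) n := by
  simp [qPoch]

theorem qPoch_dvd_of_le {m n : ℕ} (h : m ≤ n) : qPoch t m ∣ qPoch t n :=
  prod_dvd_prod_of_subset _ _ _ (range_subset_range.2 h)

/-- The Gaussian binomial coefficients are polynomials. -/
theorem qPoch_mul_dvd (a b : ℕ) : qPoch t a * qPoch t b ∣ qPoch t (a + b) := by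
  induction h : a + b generalizing a b with
  | zero =>
    obtain ⟨rfl, rfl⟩ : a = 0 ∧ b = 0 := by omega
    simp
  | succ n ih =>
    -- The `q`-Pascal recursion: `1 - t^(a+b) = (1 - t^a) + t^a (1 - t^b)`.
    cases a with
    | zero => simp [← h]
    | succ a =>
      cases b with
      | zero => simp [← h]
      | succ b =>
        have h1 := ih a (b + 1) (by omega)
        have h2 := ih (a + 1) b (by omega)
        have e : qPoch t (n + 1) = (1 - t ^ (a + 1)) * qPoch t n +
            t ^ (a + 1) * ((1 - t ^ (b + 1)) * qPoch t n) := by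
          rw [qPoch_succ, show n + 1 = (a + 1) + (b + 1) by omega, pow_add]
          ring
        rw [e]
        refine dvd_add ?_ (Dvd.dvd.mul_left ?_ _)
        · refine (dvd_of_eq ?_).trans (mul_dvd_mul_left (1 - t ^ (a + 1)) h1)
          rw [qPoch_succ t a]
          ring
        · refine (dvd_of_eq ?_).trans (mul_dvd_mul_left (1 - t ^ (b + 1)) h2)
          rw [qPoch_succ t b]
          ring

theorem qPoch_mul_dvd_of_lt {j n : ℕ} (h : j < n) :
    qPoch t j * (1 - t ^ n) ∣ qPoch t n := by
  obtain ⟨m, rfl⟩ : ∃ m, n = m + 1 := ⟨n - 1, by omega⟩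
  rw [qPoch_succ]
  exact mul_dvd_mul_right (qPoch_dvd_of_le t (by omega)) _

/-- `(t; t)_n` divides the same product in `t ^ b`, factor by factor. -/
theorem qPoch_dvd_qPoch_pow (b n : ℕ) : qPoch t n ∣ qPoch (t ^ b) n :=
  prod_dvd_prod_of_dvd _ _ fun i _ => by
    rw [← pow_mul, mul_comm, pow_mul]
    exact one_sub_dvd_one_sub_pow _ _

end qPoch

variable {K : Type*} [CommRing K]

/-- The functions `N ↦ ∑_{j ≤ w} c_j t^{jN}` for which each `c_j (t; t)_j (t; t)_{w-j}` lies in the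
subring `S`. -/
def IsQExp (S : Subring K) (t : K) (w : ℕ) (f : ℕ → K) : Prop :=
  ∃ c : ℕ → K, (∀ j ≤ w, c j * (qPoch t j * qPoch t (w - j)) ∈ S) ∧
    ∀ N, f N = ∑ j ∈ range (w + 1), c j * t ^ (j * N)

theorem mul_mem_of_dvd {S : Subring K} {u : K} {a b : S} (h : u * (a : K) ∈ S) (hab : a ∣ b) :
    u * (b : K) ∈ S := by
  obtain ⟨c, rfl⟩ := hab
  rw [Subring.coe_mul, ← mul_assoc]
  exact S.mul_mem h c.2

theorem coe_qPoch {S : Subring K} (s : S) (n : ℕ) : ((qPoch s n : S) : K) = qPoch (s : K) n :=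
  map_qPoch s S.subtype n

namespace IsQExp

variable {S : Subring K} {t : K} {w : ℕ}

theorem add {f g : ℕ → K} (hf : IsQExp S t w f) (hg : IsQExp S t w g) :
    IsQExp S t w (fun N => f N + g N) := by
  obtain ⟨c, hc, hf⟩ := hf
  obtain ⟨d, hd, hg⟩ := hg
  refine ⟨fun j => c j + d j, fun j hj => ?_, fun N => ?_⟩
  · rw [add_mul]
    exact S.add_mem (hc j hj) (hd j hj)
  · simp only [hf, hg]
    rw [← sum_add_distrib]
    exact sum_congr rfl fun j _ => by ring

theorem zero : IsQExp S t w (fun _ => 0) := by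
  refine ⟨0, fun j _ => ?_, fun N => ?_⟩
  · rw [Pi.zero_apply, zero_mul]; exact S.zero_mem
  · simp

theorem sum {ι : Type*} (s : Finset ι) {f : ι → ℕ → K} (h : ∀ i ∈ s, IsQExp S t w (f i)) :
    IsQExp S t w (fun N => ∑ i ∈ s, f i N) := by
  classical
  induction s using Finset.induction_on with
  | empty => simpa using zero
  | insert a s ha ih =>
    simp only [sum_insert ha]
    exact (h a (mem_insert_self a s)).add (ih fun i hi => h i (mem_insert_of_mem hi))

theorem single {j : ℕ} (hj : j ≤ w) {u : K} (hu : u * (qPoch t j * qPoch t (w - j)) ∈ S) :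
    IsQExp S t w (fun N => u * t ^ (j * N)) := by
  refine ⟨Pi.single j u, fun i hi => ?_, fun N => ?_⟩
  · rcases eq_or_ne i j with rfl | hij
    · rwa [Pi.single_eq_same]
    · rw [Pi.single_eq_of_ne hij, zero_mul]
      exact S.zero_mem
  · rw [sum_eq_single j]
    · rw [Pi.single_eq_same]
    · intro i _ hij
      rw [Pi.single_eq_of_ne hij, zero_mul]
    · intro h
      exact absurd (mem_range.2 (by omega)) h

/-- Summation of `N ↦ t^{kN} f(N)`: a geometric sum creates the denominator `1 - t^{j+k}`, which is
absorbed by passing from `(t; t)_j` to `(t; t)_{j+k}`. -/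
theorem sum_range {f : ℕ → K} (ht : t ∈ S) (hunit : ∀ i, 0 < i → IsUnit (1 - t ^ i))
    (hf : IsQExp S t w f) {k : ℕ} (hk : 0 < k) :
    IsQExp S t (w + k) (fun N => ∑ s ∈ range N, t ^ (s * k) * f s) := by
  obtain ⟨c, hc, hf⟩ := hf
  have key : ∀ j ≤ w, IsQExp S t (w + k)
      (fun N => ∑ s ∈ range N, t ^ (s * k) * (c j * t ^ (j * s))) := by
    intro j hj
    obtain ⟨e, he⟩ := (hunit (j + k) (by omega)).exists_right_inv
    let t' : S := ⟨t, ht⟩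
    have hmem : (c j * e) * ((qPoch t' j * (1 - t' ^ (j + k)) * qPoch t' (w - j) : S) : K) ∈ S := by
      have : (c j * e) * ((qPoch t' j * (1 - t' ^ (j + k)) * qPoch t' (w - j) : S) : K) =
          c j * (qPoch t j * qPoch t (w - j)) := by
        simp only [Subring.coe_mul, coe_qPoch, AddSubgroupClass.coe_sub, Subring.coe_one,
          Subring.coe_pow, t']
        linear_combination c j * qPoch t j * qPoch t (w - j) * he
      rw [this]
      exact hc j hj
    have d1 : qPoch t' j * (1 - t' ^ (j + k)) * qPoch t' (w - j) ∣
        qPoch t' (j + k) * qPoch t' (w - j) :=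
      mul_dvd_mul_right (qPoch_mul_dvd_of_lt t' (by omega)) _
    have d2 : qPoch t' j * (1 - t' ^ (j + k)) * qPoch t' (w - j) ∣ qPoch t' (w + k) := by
      refine d1.trans ?_
      have := qPoch_mul_dvd t' (j + k) (w - j)
      rwa [show j + k + (w - j) = w + k by omega] at this
    have h1 : IsQExp S t (w + k) (fun N => c j * e * t ^ (0 * N)) := by
      refine single (Nat.zero_le _) ?_
      have := mul_mem_of_dvd hmem d2
      simpa [coe_qPoch, t'] using this
    have h2 : IsQExp S t (w + k) (fun N => -(c j * e) * t ^ ((j + k) * N)) := by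
      refine single (by omega) ?_
      have := mul_mem_of_dvd hmem d1
      rw [neg_mul]
      refine S.neg_mem ?_
      rw [show w + k - (j + k) = w - j by omega]
      simpa [coe_qPoch, t'] using this
    have h3 := h1.add h2
    convert h3 using 2 with N
    have hg : (∑ s ∈ range N, (t ^ (j + k)) ^ s) * (1 - t ^ (j + k)) = 1 - (t ^ (j + k)) ^ N := by
      have := geom_sum_mul (t ^ (j + k)) N
      linear_combination -this
    have hs : ∀ s, t ^ (s * k) * (c j * t ^ (j * s)) = c j * (t ^ (j + k)) ^ s := by
      intro s
      rw [← pow_mul]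
      ring
    simp only [hs, ← mul_sum]
    rw [zero_mul, pow_zero, pow_mul]
    linear_combination c j * e * hg - c j * (∑ s ∈ range N, (t ^ (j + k)) ^ s) * he
  have h := IsQExp.sum (range (w + 1)) (f := fun j N =>
    ∑ s ∈ range N, t ^ (s * k) * (c j * t ^ (j * s))) fun j hj =>
      key j (Nat.lt_succ_iff.1 (mem_range.1 hj))
  convert h using 2 with N
  rw [sum_comm]
  refine sum_congr rfl fun s _ => ?_
  rw [hf, mul_sum]

end IsQExp

theorem gtSum_zero_right {R : Type*} [CommSemiring R] (x : ℕ → R) (N : ℕ) :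
    gtSum x N 0 = 1 := by
  have h0 : tail 0 = 0 := by ext; simp
  induction N with
  | zero => simp [gtSum]
  | succ N ih => simp [gtSum, h0, ih]

/-- The principal specialization `s_λ(1, t, …, t^{N-1})` as a function of `N`. -/
theorem isQExp_gtSum {S : Subring K} {t : K} (ht : t ∈ S)
    (hunit : ∀ i, 0 < i → IsUnit (1 - t ^ i)) (lam : ℕ →₀ ℕ)
    (hlam : ∀ i, lam (i + 1) ≤ lam i) :
    IsQExp S t lam.degree (fun N => gtSum (fun i => t ^ i) N lam) := by
  induction hw : lam.degree using Nat.strong_induction_on generalizing lam with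
  | _ w ih =>
    subst hw
    by_cases h0 : lam = 0
    · subst h0
      have := IsQExp.single (S := S) (t := t) (w := 0) (j := 0) le_rfl (u := 1)
        (by simp)
      simpa [gtSum_zero_right] using this
    have hself : lam ∈ Icc (tail lam) lam := mem_interlace.2 fun i => ⟨hlam i, le_rfl⟩
    have hlt : ∀ κ ∈ (Icc (tail lam) lam).erase lam, κ.degree < lam.degree := by
      intro κ hκ
      have hle := (mem_Icc.1 (mem_of_mem_erase hκ)).2
      obtain ⟨d, rfl⟩ := exists_add_of_le hle
      have hd : d ≠ 0 := by
        rintro rfl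
        exact ne_of_mem_erase hκ (by simp)
      have : d.degree ≠ 0 := fun h => hd ((Finsupp.degree_eq_zero_iff d).1 h)
      rw [map_add]
      omega
    have hrec : ∀ N, gtSum (fun i => t ^ i) N lam =
        ∑ κ ∈ (Icc (tail lam) lam).erase lam, ∑ s ∈ range N,
          t ^ (s * (lam.degree - κ.degree)) * gtSum (fun i => t ^ i) s κ := by
      intro N
      rw [sum_comm]
      induction N with
      | zero => simp [gtSum, h0]
      | succ N ihN =>
        rw [gtSum, ← add_sum_erase _ _ hself, sum_range_succ, ← ihN]
        simp [pow_mul]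
    simp only [hrec]
    refine IsQExp.sum _ fun κ hκ => ?_
    have hκ' := mem_interlace.1 (mem_of_mem_erase hκ)
    have hκlt := hlt κ hκ
    have := (ih κ.degree hκlt κ (fun i => (hκ' (i + 1)).2.trans (hκ' i).1) rfl).sum_range ht hunit
      (k := lam.degree - κ.degree) (by omega)
    rwa [show κ.degree + (lam.degree - κ.degree) = lam.degree by omega] at this

end

/-! ### Plethysm with one-row Schur polynomials in two variables -/

section

open Finset LaurentPolynomial

theorem gtSum_extendZero_equiv {R : Type*} [CommSemiring R] {m n : ℕ} (y : Fin m → R)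
    (σ : Fin n ≃ Fin m) (lam : ℕ →₀ ℕ) :
    gtSum (extendZero (y ∘ σ)) n lam = gtSum (extendZero y) m lam := by
  obtain rfl : n = m := by simpa using Fintype.card_congr σ
  exact gtSum_perm y σ lam

theorem rowLen_row (h i : ℕ) : (row h).rowLen i = if i = 0 then h else 0 := by
  refine eq_of_forall_lt_iff fun j => ?_
  rw [← YoungDiagram.mem_iff_lt_rowLen, row, YoungDiagram.mem_ofRowLens]
  constructor
  · rintro ⟨h1, h2⟩
    simp only [List.length_singleton, Nat.lt_one_iff] at h1
    subst h1
    simpa using h2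
  · intro hj
    split_ifs at hj with hi
    · subst hi
      exact ⟨by simp, by simpa using hj⟩
    · omega

/-- The filling of a row of length `h` whose last `k` entries are `1`, the others being `0`. -/
def rowFilling (h k i j : ℕ) : ℕ := if i = 0 ∧ h ≤ j + k ∧ j < h then 1 else 0

theorem isTableau_rowFilling (h k : ℕ) :
    IsTableau 2 (rowFinsupp (row h)) (rowFilling h k) := by
  intro i j
  simp only [rowFinsupp_apply, rowLen_row, rowFilling, Nat.succ_ne_zero, if_false, not_lt_zero,
    false_implies, and_true]
  refine ⟨fun _ => ?_, fun hj => ?_, fun hj => ?_⟩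
  · split_ifs <;> omega
  · rw [if_neg]
    rintro ⟨rfl, h1, h2⟩
    rw [if_pos rfl] at hj
    omega
  · split_ifs at hj ⊢ <;> omega

/-- A semistandard tableau of row shape in the letters `0, 1` is given by its number of `1`s. -/
theorem bijective_rowFilling (h : ℕ) : Function.Bijective
    (fun k : Fin (h + 1) => (ssytOfIsTableau (isTableau_rowFilling h k) : SSYT 2 (row h))) := by
  constructor
  · have key : ∀ k k' : Fin (h + 1), ssytOfIsTableau (isTableau_rowFilling h k) =
        ssytOfIsTableau (isTableau_rowFilling h k') → k'.1 ≤ k.1 := by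
      intro k k' hk
      by_contra hlt
      have hlt' := k'.2
      have h1 : rowFilling h k 0 (h - k') = rowFilling h k' 0 (h - k') :=
        congrArg (fun T : SSYT 2 (row h) => T.1 0 (h - k')) hk
      simp only [rowFilling, true_and] at h1
      split_ifs at h1 <;> omega
    intro k k' hk
    exact Fin.ext (le_antisymm (key _ _ hk.symm) (key _ _ hk))
  · intro T
    have hT := isTableau_of_ssyt T
    have hm : innerShape 1 (rowFinsupp (row h)) (fun i j => T.1 i j) 0 ≤ h := by
      by_contra hlt
      have := (hT.lt_innerShape_iff 0 h).1 (by omega)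
      simp [rowLen_row] at this
    refine ⟨⟨h - innerShape 1 (rowFinsupp (row h)) (fun i j => T.1 i j) 0, by omega⟩, ?_⟩
    apply Subtype.ext
    ext i j
    have hij := hT i j
    have hin := hT.lt_innerShape_iff 0 j
    simp only [rowFinsupp_apply, rowLen_row, if_true] at hij hin
    change rowFilling _ _ i j = _
    simp only [rowFilling]
    by_cases hi : i = 0
    · subst hi
      rw [if_pos rfl] at hij
      have h1 := hij.1
      have h2 := hij.2.1
      split_ifs <;> omega
    · rw [if_neg hi] at hij
      rw [if_neg fun h => hi h.1, hij.2.1 (Nat.zero_le _)]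

/-- The value of the monomial of the tableau with `k` entries `1`. -/
theorem aeval_monomial_rowFilling (h : ℕ) (k : Fin (h + 1)) :
    MvPolynomial.aeval ![(T 1 : LaurentPolynomial ℤ), T (-1)]
      (ssytOfIsTableau (isTableau_rowFilling h k) : SSYT 2 (row h)).monomial =
      T ((h : ℤ) - 2 * (k : ℕ)) := by
  rw [SSYT.monomial, map_prod]
  simp only [MvPolynomial.aeval_X]
  have hval : ∀ (n : ℕ) (hn : n < 2), ![(T 1 : LaurentPolynomial ℤ), T (-1)] ⟨n, hn⟩ =
      T (1 - 2 * (n : ℤ)) := by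
    intro n hn
    interval_cases n <;> simp
  have hp : ∀ c ∈ (row h).cells.attach,
      ![(T 1 : LaurentPolynomial ℤ), T (-1)]
        ⟨(ssytOfIsTableau (isTableau_rowFilling h k) : SSYT 2 (row h)).1 c.1.1 c.1.2,
          (ssytOfIsTableau (isTableau_rowFilling h k) : SSYT 2 (row h)).2 c.1 c.2⟩ =
        T (1 - 2 * (rowFilling h k c.1.1 c.1.2 : ℤ)) := fun c _ => hval _ _
  rw [prod_congr rfl hp, prod_attach _ (fun c : ℕ × ℕ => T (1 - 2 * (rowFilling h k c.1 c.2 : ℤ))),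
    prod_cells, prod_subset (s₂ := {0})]
  · have : ∀ m ≤ h, ∏ j ∈ range m, (T (1 - 2 * (rowFilling h k 0 j : ℤ)) : LaurentPolynomial ℤ) =
        T ((m : ℤ) - 2 * ((m + k - h : ℕ) : ℤ)) := by
      intro m hm
      induction m with
      | zero =>
        rw [show 0 + (k : ℕ) - h = 0 by omega]
        simp
      | succ m ih =>
        rw [prod_range_succ, ih (by omega), ← T_add]
        congr 1
        simp only [rowFilling, true_and]
        split_ifs <;> push_cast <;> omega
    rw [prod_singleton, rowLen_row, if_pos rfl, this h le_rfl]
    congr 2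
    omega
  · intro i hi
    rw [Finsupp.mem_support_iff, rowFinsupp_apply, rowLen_row] at hi
    rw [mem_singleton]
    by_contra h0
    exact hi (if_neg h0)
  · intro i _ hi
    rw [Finsupp.notMem_support_iff, rowFinsupp_apply] at hi
    rw [hi, range_zero, prod_empty]

/-- `s_μ[s_h](q, q⁻¹) = s_μ(q^h, q^{h-2}, …, q^{-h})`. -/
theorem plethysmSL2_eq_gtSum (μ : YoungDiagram) (h : ℕ) :
    plethysmSL2 μ h = gtSum (fun i => T ((h : ℤ) - 2 * (i : ℤ))) (h + 1) (rowFinsupp μ) := by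
  let e := Equiv.ofBijective _ (bijective_rowFilling h)
  have hc : ∀ n (σ : SSYT 2 (row h) ≃ Fin n),
      MvPolynomial.aeval ![(T 1 : LaurentPolynomial ℤ), T (-1)]
        (MvPolynomial.aeval (fun i : Fin n => (σ.symm i).monomial) (schur n μ)) =
      gtSum (fun i => T ((h : ℤ) - 2 * (i : ℤ))) (h + 1) (rowFinsupp μ) := by
    intro n σ
    rw [← AlgHom.comp_apply, MvPolynomial.comp_aeval, aeval_schur]
    have hy : (fun i : Fin n => MvPolynomial.aeval ![(T 1 : LaurentPolynomial ℤ), T (-1)]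
        (σ.symm i).monomial) =
        (fun k : Fin (h + 1) => (T ((h : ℤ) - 2 * ((k : ℕ) : ℤ)) : LaurentPolynomial ℤ)) ∘
          (σ.symm.trans e.symm) := by
      funext i
      rw [Function.comp, ← aeval_monomial_rowFilling]
      congr 2
      exact (e.apply_symm_apply (σ.symm i)).symm
    rw [hy, gtSum_extendZero_equiv]
    exact gtSum_congr (fun i hi => by rw [extendZero, dif_pos hi]) _
  exact hc _ _

theorem plethysmSL2_eq_gtSum' (μ : YoungDiagram) (h : ℕ) :
    plethysmSL2 μ h = gtSum (fun i => T (2 * (i : ℤ) - (h : ℤ))) (h + 1) (rowFinsupp μ) := by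
  rw [plethysmSL2_eq_gtSum]
  have := gtSum_perm (fun k : Fin (h + 1) => (T ((h : ℤ) - 2 * ((k : ℕ) : ℤ)) :
    LaurentPolynomial ℤ)) Fin.revPerm (rowFinsupp μ)
  rw [gtSum_congr (y := extendZero fun k : Fin (h + 1) => T ((h : ℤ) - 2 * ((k : ℕ) : ℤ)))
    (fun i hi => by rw [extendZero, dif_pos hi]), ← this]
  refine gtSum_congr (fun i hi => ?_) _
  rw [extendZero, dif_pos hi]
  simp only [Function.comp, Fin.revPerm_apply, Fin.val_rev]
  congr 1
  omega

theorem invert_plethysmSL2 (μ : YoungDiagram) (h : ℕ) :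
    invert (plethysmSL2 μ h) = plethysmSL2 μ h := by
  conv_lhs => rw [plethysmSL2_eq_gtSum]
  rw [plethysmSL2_eq_gtSum']
  have := map_gtSum (invert (R := ℤ) : LaurentPolynomial ℤ →+* LaurentPolynomial ℤ)
    (fun i => T ((h : ℤ) - 2 * (i : ℤ))) (h + 1) (rowFinsupp μ)
  refine this.trans (gtSum_congr (fun i _ => ?_) _)
  change invert (T _) = _
  rw [invert_T]
  congr 1
  ring

/-- Laurent polynomials invariant under `q ↦ q⁻¹` are combinations of the `[k]_q`. -/
theorem exists_isExpansion {F : LaurentPolynomial ℤ} (hF : invert F = F) :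
    ∃ c, IsExpansion F c := by
  set H := F * (T 1 - T (-1)) with hH
  have hinv : invert H = -H := by
    rw [hH, map_mul, map_sub, invert_T, invert_T, hF, neg_neg]
    ring
  have hanti : ∀ n : ℤ, H.coeff (-n) = -H.coeff n := by
    intro n
    have := congrArg (fun G : LaurentPolynomial ℤ => G.coeff n) hinv
    simpa [invert_apply] using this
  have h0 : H.coeff 0 = 0 := by
    have := hanti 0
    rw [neg_zero] at this
    omega
  let c : ℕ →₀ ℤ := H.coeff.comapDomain (fun n : ℕ => (n : ℤ)) Nat.cast_injective.injOn
  have hcapp : ∀ n : ℕ, c n = H.coeff (n : ℤ) := fun n => rfl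
  refine ⟨c, h0, ?_⟩
  have hne : (T 1 - T (-1) : LaurentPolynomial ℤ) ≠ 0 := by
    intro h
    have := congrArg (fun G : LaurentPolynomial ℤ => G.coeff 1) h
    simp at this
  refine mul_right_cancel₀ hne ?_
  rw [← hH]
  apply LaurentPolynomial.ext
  have hcoeff : ∀ n : ℤ, ((c.sum fun k a => a • qInt k) * (T 1 - T (-1))).coeff n =
      ∑ k ∈ c.support, c k * ((if (k : ℤ) = n then 1 else 0) - if (k : ℤ) = -n then 1 else 0) := by
    intro n
    rw [Finsupp.sum, Finset.sum_mul, AddMonoidAlgebra.coeff_sum, Finsupp.finsetSum_apply]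
    refine sum_congr rfl fun k _ => ?_
    rw [smul_mul_assoc, qInt_mul, AddMonoidAlgebra.coeff_smul, AddMonoidAlgebra.coeff_sub,
      Finsupp.smul_apply, Finsupp.sub_apply, T_apply, T_apply, smul_eq_mul]
    simp only [neg_eq_iff_eq_neg]
  have hpos : ∀ m : ℕ, ∑ k ∈ c.support, c k * (if (k : ℤ) = m then (1 : ℤ) else 0) =
      H.coeff (m : ℤ) := by
    intro m
    rw [← hcapp]
    simp [eq_comm]
  have hneg : ∀ m : ℕ, ∑ k ∈ c.support, c k * (if (k : ℤ) = -m then (1 : ℤ) else 0) = 0 := by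
    intro m
    refine sum_eq_zero fun k hk => ?_
    rw [if_neg, mul_zero]
    intro hkm
    obtain rfl : k = 0 := by omega
    exact (Finsupp.mem_support_iff.1 hk) h0
  intro n
  rw [hcoeff]
  simp only [mul_sub, sum_sub_distrib]
  obtain ⟨m, rfl | rfl⟩ := n.eq_nat_or_neg
  · rw [hpos, hneg, sub_zero]
  · rw [hneg, neg_neg, hpos, hanti, zero_sub]

/-- The plethysm coefficients are the coefficients of the positive part of
`(q - q⁻¹) s_μ[s_h](q, q⁻¹)`. -/
theorem coeff_eq (μ : YoungDiagram) (h : ℕ) {k : ℕ} (hk : 1 ≤ k) :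
    coeff μ h k = (plethysmSL2 μ h * (T 1 - T (-1))).coeff (k : ℤ) := by
  have hex := exists_isExpansion (invert_plethysmSL2 μ h)
  rw [coeff, dif_pos hex]
  exact hex.choose_spec.coeff_eq hk

end

/-! ### Positive parts of power series -/

section

open Finset LaurentPolynomial

section Bounded

/-- A power series in `z, q` whose degree in `z` is bounded. -/
def ZBounded (B : MvPowerSeries (Fin 2) ℤ) : Prop :=
  ∃ H, ∀ m : Fin 2 →₀ ℕ, H ≤ m 0 → MvPowerSeries.coeff m B = 0

/-- A power series in `z, q` for which the coefficient of each `z ^ h` is a polynomial in `q`. -/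
def QBounded (B : MvPowerSeries (Fin 2) ℤ) : Prop :=
  ∀ h, ∃ N, ∀ m : Fin 2 →₀ ℕ, m 0 = h → N ≤ m 1 → MvPowerSeries.coeff m B = 0

theorem coeff_coe_monomial_mul (s m : Fin 2 →₀ ℕ) (a : ℤ) (B : MvPowerSeries (Fin 2) ℤ) :
    MvPowerSeries.coeff m (((MvPolynomial.monomial s a : MvPolynomial (Fin 2) ℤ) :
      MvPowerSeries (Fin 2) ℤ) * B) = if s ≤ m then a * MvPowerSeries.coeff (m - s) B else 0 := by
  rw [MvPolynomial.coe_monomial, MvPowerSeries.coeff_monomial_mul]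

theorem ZBounded.add {A B : MvPowerSeries (Fin 2) ℤ} (hA : ZBounded A) (hB : ZBounded B) :
    ZBounded (A + B) := by
  obtain ⟨H, hA⟩ := hA
  obtain ⟨H', hB⟩ := hB
  refine ⟨max H H', fun m hm => ?_⟩
  rw [map_add, hA m ((le_max_left _ _).trans hm), hB m ((le_max_right _ _).trans hm), add_zero]

theorem QBounded.add {A B : MvPowerSeries (Fin 2) ℤ} (hA : QBounded A) (hB : QBounded B) :
    QBounded (A + B) := by
  intro h
  obtain ⟨N, hA⟩ := hA h
  obtain ⟨N', hB⟩ := hB h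
  refine ⟨max N N', fun m h0 hm => ?_⟩
  rw [map_add, hA m h0 ((le_max_left _ _).trans hm), hB m h0 ((le_max_right _ _).trans hm),
    add_zero]

theorem ZBounded.sum {ι : Type*} (s : Finset ι) {B : ι → MvPowerSeries (Fin 2) ℤ}
    (h : ∀ i ∈ s, ZBounded (B i)) : ZBounded (∑ i ∈ s, B i) :=
  Finset.sum_induction B ZBounded (fun _ _ => ZBounded.add) ⟨0, fun _ _ => map_zero _⟩ h

theorem ZBounded.coe_mul {B : MvPowerSeries (Fin 2) ℤ} (hB : ZBounded B)
    (p : MvPolynomial (Fin 2) ℤ) : ZBounded ((p : MvPowerSeries (Fin 2) ℤ) * B) := by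
  induction p using MvPolynomial.induction_on' with
  | add p r hp hr =>
    rw [MvPolynomial.coe_add, add_mul]
    exact hp.add hr
  | monomial s a =>
    obtain ⟨H, hB⟩ := hB
    refine ⟨H + s 0, fun m hm => ?_⟩
    rw [coeff_coe_monomial_mul, hB, mul_zero, ite_self]
    rw [Finsupp.tsub_apply]
    omega

theorem QBounded.coe_mul {B : MvPowerSeries (Fin 2) ℤ} (hB : QBounded B)
    (p : MvPolynomial (Fin 2) ℤ) : QBounded ((p : MvPowerSeries (Fin 2) ℤ) * B) := by
  induction p using MvPolynomial.induction_on' with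
  | add p r hp hr =>
    rw [MvPolynomial.coe_add, add_mul]
    exact hp.add hr
  | monomial s a =>
    intro h
    obtain ⟨N, hB⟩ := hB (h - s 0)
    refine ⟨N + s 1, fun m h0 hm => ?_⟩
    rw [coeff_coe_monomial_mul, hB, mul_zero, ite_self]
    · rw [Finsupp.tsub_apply, h0]
    · rw [Finsupp.tsub_apply]
      omega

theorem ZBounded.of_dvd {B : MvPowerSeries (Fin 2) ℤ} {f d : MvPolynomial (Fin 2) ℤ}
    (h : ZBounded ((f : MvPowerSeries (Fin 2) ℤ) * B)) (hd : f ∣ d) :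
    ZBounded ((d : MvPowerSeries (Fin 2) ℤ) * B) := by
  obtain ⟨c, rfl⟩ := hd
  rw [mul_comm f c, MvPolynomial.coe_mul, mul_assoc]
  exact h.coe_mul c

theorem exists_mvPolynomial_eq {B : MvPowerSeries (Fin 2) ℤ} (hz : ZBounded B)
    (hq : QBounded B) : ∃ p : MvPolynomial (Fin 2) ℤ, B = (p : MvPowerSeries (Fin 2) ℤ) := by
  obtain ⟨H, hz⟩ := hz
  choose N hN using hq
  let M := H + (range H).sup N
  have hM : ∀ m : Fin 2 →₀ ℕ, MvPowerSeries.coeff m B ≠ 0 →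
      m ∈ Iic (Finsupp.equivFunOnFinite.symm fun _ : Fin 2 => M) := by
    intro m hm
    have h0 : m 0 < H := by
      by_contra h
      exact hm (hz m (by omega))
    have h1 : m 1 < N (m 0) := by
      by_contra h
      exact hm (hN _ m rfl (by omega))
    have h2 : N (m 0) ≤ (range H).sup N := le_sup (mem_range.2 h0)
    rw [mem_Iic, Finsupp.le_def]
    intro i
    have h3 : m i ≤ M := by
      fin_cases i
      · change m 0 ≤ H + _
        omega
      · change m 1 ≤ H + _
        omega
    exact h3
  refine ⟨AddMonoidAlgebra.ofCoeff (Finsupp.onFinset _ (fun m => MvPowerSeries.coeff m B) hM), ?_⟩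
  ext m
  rw [MvPolynomial.coeff_coe]
  rfl

end Bounded

section Laurent

/-- The monomial `q ^ n`, for `n` an integer, as a formal Laurent series. -/
noncomputable def qPow (n : ℤ) : LaurentSeries ℤ := HahnSeries.single n 1

theorem qPow_add (m n : ℤ) : qPow (m + n) = qPow m * qPow n := by
  simp [qPow, HahnSeries.single_mul_single]

@[simp]
theorem qPow_zero : qPow 0 = 1 := rfl

theorem qPow_pow (m : ℤ) (n : ℕ) : qPow m ^ n = qPow (n * m) := by
  simp [qPow, HahnSeries.single_pow]

theorem coeff_mul_qPow (x : LaurentSeries ℤ) (m n : ℤ) :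
    (x * qPow m).coeff n = x.coeff (n - m) := by
  rw [qPow, HahnSeries.coeff_mul_single, mul_one]

/-- Laurent polynomials as Laurent series. -/
noncomputable def toSeries : LaurentPolynomial ℤ →+* LaurentSeries ℤ :=
  eval₂ (Int.castRingHom _) ⟨qPow 1, qPow (-1), by rw [← qPow_add]; simp, by rw [← qPow_add]; simp⟩

theorem toSeries_T (n : ℤ) : toSeries (T n) = qPow n := by
  rw [toSeries, eval₂_T]
  obtain ⟨m, rfl | rfl⟩ := n.eq_nat_or_neg
  · rw [zpow_natCast, Units.val_pow_eq_pow_val, qPow_pow, mul_one]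
  · rw [zpow_neg, zpow_natCast, ← inv_pow, Units.val_pow_eq_pow_val]
    change qPow (-1) ^ m = _
    rw [qPow_pow, mul_neg_one]

theorem coeff_toSeries (r : LaurentPolynomial ℤ) (n : ℤ) :
    (toSeries r).coeff n = r.coeff n := by
  induction r using LaurentPolynomial.induction_on' with
  | add p r hp hr => simp [hp, hr]
  | C_mul_T m a =>
    have h : (C a : LaurentPolynomial ℤ) * T m = a • T m := by
      rw [LaurentPolynomial.smul_eq_C_mul]
    rw [h, map_zsmul, toSeries_T, AddMonoidAlgebra.coeff_smul, Finsupp.smul_apply, T_apply,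
      HahnSeries.coeff_smul, qPow, HahnSeries.coeff_single]
    rcases eq_or_ne n m with rfl | hnm
    · rw [if_pos rfl, if_pos rfl]
    · rw [if_neg hnm, if_neg hnm.symm]

theorem exists_coeff_eq_zero_of_ge (r : LaurentPolynomial ℤ) :
    ∃ N : ℕ, ∀ n : ℤ, (N : ℤ) ≤ n → r.coeff n = 0 := by
  refine ⟨r.coeff.support.sup Int.natAbs + 1, fun n hn => ?_⟩
  by_contra h
  have := le_sup (f := Int.natAbs) (Finsupp.mem_support_iff.2 h)
  omega

theorem exists_coeff_eq_zero_of_lt (x : LaurentSeries ℤ) :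
    ∃ N : ℕ, ∀ n : ℤ, n < -(N : ℤ) → x.coeff n = 0 :=
  ⟨x.order.natAbs, fun n hn => HahnSeries.coeff_eq_zero_of_lt_order (by omega)⟩

theorem isUnit_one_sub_qPow {n : ℕ} (hn : 0 < n) : IsUnit (1 - qPow n) := by
  have h : IsUnit (1 - PowerSeries.X ^ n : PowerSeries ℤ) := by
    rw [PowerSeries.isUnit_iff_constantCoeff]
    simp [hn.ne']
  have h' := h.map (HahnSeries.ofPowerSeries ℤ ℤ)
  rwa [map_sub, map_one, HahnSeries.ofPowerSeries_X_pow] at h'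

end Laurent

section Positive

/-- The part of `∑ h, g h z ^ h` with positive exponents of `q`. -/
noncomputable def posSeries (g : ℕ → LaurentSeries ℤ) : MvPowerSeries (Fin 2) ℤ :=
  fun m => if 1 ≤ m 1 then (g (m 0)).coeff (m 1) else 0

theorem coeff_posSeries (g : ℕ → LaurentSeries ℤ) (m : Fin 2 →₀ ℕ) :
    MvPowerSeries.coeff m (posSeries g) = if 1 ≤ m 1 then (g (m 0)).coeff (m 1) else 0 := rfl

theorem posSeries_sum {ι : Type*} (s : Finset ι) (g : ι → ℕ → LaurentSeries ℤ) :
    posSeries (fun h => ∑ i ∈ s, g i h) = ∑ i ∈ s, posSeries (g i) := by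
  ext m
  rw [map_sum]
  simp only [coeff_posSeries]
  split_ifs
  · simp
  · simp

/-- For `a > 0` the exponents of `q` in `∑ h, γ q^{ah} z^h` are positive except for finitely many
terms, so that taking the positive part does not affect the denominator. -/
theorem zBounded_of_pos (γ : LaurentSeries ℤ) {a : ℕ} (ha : 0 < a) :
    ZBounded (((1 - MvPolynomial.X 1 ^ a * MvPolynomial.X 0 : MvPolynomial (Fin 2) ℤ) :
      MvPowerSeries (Fin 2) ℤ) * posSeries (fun h => γ * qPow (a * h))) := by
  obtain ⟨N, hN⟩ := exists_coeff_eq_zero_of_lt γ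
  refine ⟨N + 2, fun m hm => ?_⟩
  have hmono : (MvPolynomial.X 1 ^ a * MvPolynomial.X 0 : MvPolynomial (Fin 2) ℤ) =
      MvPolynomial.monomial (Finsupp.single 1 a + Finsupp.single 0 1) 1 := by
    rw [MvPolynomial.X_pow_eq_monomial, MvPolynomial.X, MvPolynomial.monomial_mul, one_mul]
  have hcoe : ((1 - MvPolynomial.X 1 ^ a * MvPolynomial.X 0 : MvPolynomial (Fin 2) ℤ) :
      MvPowerSeries (Fin 2) ℤ) = 1 -
        ((MvPolynomial.X 1 ^ a * MvPolynomial.X 0 : MvPolynomial (Fin 2) ℤ) :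
          MvPowerSeries (Fin 2) ℤ) := by
    have := map_sub (MvPolynomial.coeToMvPowerSeries.ringHom (σ := Fin 2) (R := ℤ)) 1
      (MvPolynomial.X 1 ^ a * MvPolynomial.X 0)
    rwa [map_one] at this
  rw [hcoe, sub_mul, one_mul, map_sub, hmono,
    coeff_coe_monomial_mul, coeff_posSeries, coeff_posSeries]
  have hs : (Finsupp.single 1 a + Finsupp.single 0 1 : Fin 2 →₀ ℕ) ≤ m ↔ a ≤ m 1 := by
    rw [Finsupp.le_def, Fin.forall_fin_two]
    simp
    omega
  have e1 : (m - (Finsupp.single 1 a + Finsupp.single 0 1) : Fin 2 →₀ ℕ) 1 = m 1 - a := by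
    simp
  have e0 : (m - (Finsupp.single 1 a + Finsupp.single 0 1) : Fin 2 →₀ ℕ) 0 = m 0 - 1 := by
    simp
  rw [e1, e0, one_mul, coeff_mul_qPow, coeff_mul_qPow]
  simp only [hs]
  have hlarge : (N : ℤ) + 2 ≤ m 0 := by exact_mod_cast hm
  have ha' : (1 : ℤ) ≤ a := by exact_mod_cast ha
  by_cases h : a + 1 ≤ m 1
  · rw [if_pos (by omega), if_pos (by omega), if_pos (by omega)]
    have : ((m 1 - a : ℕ) : ℤ) - a * ((m 0 - 1 : ℕ) : ℤ) = (m 1 : ℤ) - a * (m 0 : ℤ) := by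
      rw [Nat.cast_sub (by omega), Nat.cast_sub (by omega)]
      push_cast
      ring
    rw [this, sub_self]
  · have h1 : γ.coeff ((m 1 : ℤ) - a * (m 0 : ℤ)) = 0 := by
      apply hN
      have : (m 1 : ℤ) ≤ a := by omega
      nlinarith
    rw [h1, ite_self]
    split_ifs <;> omega

theorem coeff_aeval_X_mul_posSeries (p : Polynomial ℤ) (g : ℕ → LaurentSeries ℤ)
    (m : Fin 2 →₀ ℕ) (hm : p.natDegree ≤ m 0) (h1 : 1 ≤ m 1) :
    MvPowerSeries.coeff m
      (((Polynomial.aeval (MvPolynomial.X 0) p : MvPolynomial (Fin 2) ℤ) :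
        MvPowerSeries (Fin 2) ℤ) * posSeries g) =
      (∑ i ∈ range (p.natDegree + 1), (p.coeff i : LaurentSeries ℤ) * g (m 0 - i)).coeff (m 1) := by
  have hp : (Polynomial.aeval (MvPolynomial.X 0) p : MvPolynomial (Fin 2) ℤ) =
      ∑ i ∈ range (p.natDegree + 1), MvPolynomial.monomial (Finsupp.single 0 i) (p.coeff i) := by
    rw [Polynomial.aeval_eq_sum_range]
    refine sum_congr rfl fun i _ => ?_
    rw [MvPolynomial.X_pow_eq_monomial, MvPolynomial.smul_monomial, smul_eq_mul, mul_one]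
  have hcoe : ((∑ i ∈ range (p.natDegree + 1),
      MvPolynomial.monomial (Finsupp.single 0 i) (p.coeff i) : MvPolynomial (Fin 2) ℤ) :
        MvPowerSeries (Fin 2) ℤ) = ∑ i ∈ range (p.natDegree + 1),
      ((MvPolynomial.monomial (Finsupp.single 0 i) (p.coeff i) : MvPolynomial (Fin 2) ℤ) :
        MvPowerSeries (Fin 2) ℤ) :=
    map_sum MvPolynomial.coeToMvPowerSeries.ringHom _ _
  rw [hp, hcoe, sum_mul, map_sum, HahnSeries.coeff_sum]
  refine sum_congr rfl fun i hi => ?_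
  have hi' : i ≤ m 0 := by
    have := mem_range.1 hi
    omega
  rw [coeff_coe_monomial_mul, if_pos (by simpa using hi'), coeff_posSeries]
  have e1 : (m - Finsupp.single 0 i : Fin 2 →₀ ℕ) 1 = m 1 := by simp
  have e0 : (m - Finsupp.single 0 i : Fin 2 →₀ ℕ) 0 = m 0 - i := by simp
  rw [e1, e0, if_pos h1, ← zsmul_eq_mul, HahnSeries.coeff_smul, smul_eq_mul]

/-- Multiplication by `p(z)` commutes with taking the positive part. On `∑ h, γ q^{-bh} z^h` it
amounts, for large `h`, to multiplication of `γ` by `p(q^b)`; if this is a Laurent polynomial, its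
product with `q^{-bh}` has no positive part for large `h`. -/
theorem zBounded_of_neg {γ : LaurentSeries ℤ} {b : ℕ} {p : Polynomial ℤ}
    {r : LaurentPolynomial ℤ} (hr : γ * Polynomial.aeval (qPow b) p = toSeries r)
    (hb : 0 < b ∨ r = 0) :
    ZBounded (((Polynomial.aeval (MvPolynomial.X 0) p : MvPolynomial (Fin 2) ℤ) :
      MvPowerSeries (Fin 2) ℤ) * posSeries (fun h => γ * qPow (-(b * h)))) := by
  obtain ⟨N, hN⟩ := exists_coeff_eq_zero_of_ge r
  refine ⟨N + p.natDegree, fun m hm => ?_⟩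
  by_cases h1 : 1 ≤ m 1
  · rw [coeff_aeval_X_mul_posSeries _ _ _ (by omega) h1]
    have h : ∑ i ∈ range (p.natDegree + 1), (p.coeff i : LaurentSeries ℤ) *
        (γ * qPow (-(b * ((m 0 - i : ℕ) : ℤ)))) =
        toSeries r * qPow (-(b * (m 0 : ℤ))) := by
      rw [← hr, Polynomial.aeval_eq_sum_range, mul_sum, sum_mul]
      refine sum_congr rfl fun i hi => ?_
      have hi' : i ≤ m 0 := by
        have := mem_range.1 hi
        omega
      have e : -((b : ℤ) * ((m 0 - i : ℕ) : ℤ)) = i * b + -(b * (m 0 : ℤ)) := by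
        rw [Nat.cast_sub hi']
        ring
      rw [e, qPow_add, qPow_pow, Algebra.smul_def, eq_intCast]
      ring
    rw [h, coeff_mul_qPow, coeff_toSeries]
    rcases hb with hb | rfl
    · apply hN
      have h2 : (N : ℤ) ≤ m 0 := by
        have : N ≤ m 0 := by omega
        exact_mod_cast this
      have h3 : (1 : ℤ) ≤ b := by exact_mod_cast hb
      nlinarith
    · rfl
  · rw [MvPowerSeries.coeff_mul]
    refine sum_eq_zero fun x hx => ?_
    have hx' := congrArg (fun s : Fin 2 →₀ ℕ => s 1) (mem_antidiagonal.1 hx)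
    simp only [Finsupp.add_apply] at hx'
    rw [coeff_posSeries, if_neg (by omega), mul_zero]

end Positive

end

/-! ### The denominator -/

section

open Finset LaurentPolynomial

theorem prod_Icc_one_eq {R : Type*} [CommRing R] (f : ℕ → R) (w : ℕ) :
    ∏ i ∈ Icc 1 w, f i = ∏ i ∈ range w, f (i + 1) := by
  rw [range_eq_Ico, prod_Ico_add' f 0 w 1]
  rfl

theorem aeval_qPoch {A : Type*} [CommRing A] [Algebra ℤ A] (a : A) (x : Polynomial ℤ) (n : ℕ) :
    Polynomial.aeval a (qPoch x n) = qPoch (Polynomial.aeval a x) n :=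
  map_qPoch x (Polynomial.aeval (R := ℤ) a : Polynomial ℤ →+* A) n

/-- The factors of the denominator that depend on `z` alone, except for the extra factor `1 - z` for
even `w`. -/
noncomputable def zDenom (w : ℕ) : Polynomial ℤ :=
  if Even w then qPoch Polynomial.X w else qPoch (Polynomial.X ^ 2) w

theorem aeval_zDenom_dvd_denom (w : ℕ) :
    (Polynomial.aeval (MvPolynomial.X 0) (zDenom w) : MvPolynomial (Fin 2) ℤ) ∣ denom w := by
  rw [zDenom, denom]
  split_ifs
  · rw [aeval_qPoch, Polynomial.aeval_X, qPoch,
      ← prod_Icc_one_eq (fun i => 1 - (MvPolynomial.X 0 : MvPolynomial (Fin 2) ℤ) ^ i)]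
    exact (dvd_mul_left _ _).mul_right _
  · rw [aeval_qPoch, map_pow, Polynomial.aeval_X, qPoch]
    simp only [← pow_mul]
    rw [← prod_Icc_one_eq (fun i => 1 - (MvPolynomial.X 0 : MvPolynomial (Fin 2) ℤ) ^ (2 * i))]
    exact dvd_mul_right _ _

theorem one_sub_dvd_denom {w a : ℕ} (ha : 0 < a) (haw : a ≤ w) (hpar : Even (w + a)) :
    (1 - MvPolynomial.X 1 ^ a * MvPolynomial.X 0 : MvPolynomial (Fin 2) ℤ) ∣ denom w := by
  rw [denom]
  split_ifs with hw
  · obtain ⟨i, rfl⟩ : Even a := (Nat.even_add.1 hpar).1 hw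
    rw [← two_mul]
    refine Dvd.dvd.mul_left ?_ _
    exact dvd_prod_of_mem (fun i => 1 - (MvPolynomial.X 1 : MvPolynomial (Fin 2) ℤ) ^ (2 * i) *
      MvPolynomial.X 0) (mem_Icc.2 (by omega))
  · have hodd : ¬ Even a := fun h => hw ((Nat.even_add.1 hpar).2 h)
    obtain ⟨i, rfl⟩ := Nat.not_even_iff_odd.1 hodd
    refine Dvd.dvd.mul_left ?_ _
    exact dvd_prod_of_mem (fun i => 1 - (MvPolynomial.X 1 : MvPolynomial (Fin 2) ℤ) ^ (2 * i - 1) *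
      MvPolynomial.X 0) (a := i + 1) (mem_Icc.2 (by omega))

theorem aeval_one_sub_X_dvd_denom {w : ℕ} (hw : Even w) :
    (Polynomial.aeval (MvPolynomial.X 0) (1 - Polynomial.X : Polynomial ℤ) :
      MvPolynomial (Fin 2) ℤ) ∣ denom w := by
  rw [denom, if_pos hw, map_sub, map_one, Polynomial.aeval_X]
  exact (dvd_mul_right _ _).mul_right _

/-- `(q²; q²)_w` divides `p(q^b)`, where `p` is `zDenom w` and `b` has the parity of `w`. -/
theorem qPoch_dvd_aeval_zDenom {A : Type*} [CommRing A] (x : A) {w b : ℕ}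
    (hpar : Even (w + b)) : qPoch (x ^ 2) w ∣ Polynomial.aeval (x ^ b) (zDenom w) := by
  rw [zDenom]
  split_ifs with hw
  · obtain ⟨i, rfl⟩ : Even b := (Nat.even_add.1 hpar).1 hw
    rw [aeval_qPoch, Polynomial.aeval_X, ← two_mul, pow_mul]
    exact qPoch_dvd_qPoch_pow _ _ _
  · rw [aeval_qPoch, map_pow, Polynomial.aeval_X, ← pow_mul, mul_comm, pow_mul]
    exact qPoch_dvd_qPoch_pow _ _ _

/-- `(q - q⁻¹) s_μ[s_h](q, q⁻¹)` is a combination of the `q^{(2j-w)h}`, for `0 ≤ j ≤ w`, whose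
coefficients have the denominator `(q²; q²)_w`. -/
theorem exists_expansion (μ : YoungDiagram) : ∃ γ : ℕ → LaurentSeries ℤ,
    (∀ j ≤ μ.card, γ j * qPoch (qPow 2) μ.card ∈ toSeries.range) ∧
    ∀ h : ℕ, toSeries (plethysmSL2 μ h * (T 1 - T (-1))) =
      ∑ j ∈ range (μ.card + 1), γ j * qPow ((2 * (j : ℤ) - μ.card) * h) := by
  set w := μ.card with hw
  have ht : qPow 2 ∈ toSeries.range := ⟨T 2, toSeries_T 2⟩
  have hunit : ∀ i, 0 < i → IsUnit (1 - qPow 2 ^ i) := by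
    intro i hi
    have := isUnit_one_sub_qPow (n := i * 2) (by omega)
    rw [qPow_pow]
    exact_mod_cast this
  obtain ⟨c, hc, hsum⟩ := isQExp_gtSum ht hunit (rowFinsupp μ) (rowFinsupp_succ_le μ)
  rw [degree_rowFinsupp, ← hw] at hc hsum
  beta_reduce at hsum
  refine ⟨fun j => toSeries (T 1 - T (-1)) * c j * qPow 2 ^ j, fun j hj => ?_, fun h => ?_⟩
  · let t' : toSeries.range := ⟨qPow 2, ht⟩
    have hd := qPoch_mul_dvd t' j (w - j)
    rw [Nat.add_sub_cancel' hj] at hd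
    have h1 : c j * ((qPoch t' j * qPoch t' (w - j) : toSeries.range) : LaurentSeries ℤ) ∈
        toSeries.range := by
      have := hc j hj
      simpa only [Subring.coe_mul, coe_qPoch, t'] using this
    have h2 := mul_mem_of_dvd h1 hd
    rw [coe_qPoch] at h2
    have h3 := toSeries.range.mul_mem (toSeries.range.mul_mem ⟨T 1 - T (-1), rfl⟩ h2)
      (toSeries.range.pow_mem ht j)
    refine (congrArg (· ∈ toSeries.range) ?_).mp h3
    ring
  · have e1 : ∀ i : ℕ, (T (2 * (i : ℤ) - (h : ℤ)) : LaurentPolynomial ℤ) =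
        T (-(h : ℤ)) * T 2 ^ i := by
      intro i
      rw [T_pow, ← T_add]
      congr 1
      ring
    rw [plethysmSL2_eq_gtSum']
    simp only [e1]
    rw [gtSum_const_mul, degree_rowFinsupp, ← hw, map_mul, map_mul, map_gtSum, map_pow]
    simp only [map_pow, toSeries_T]
    rw [hsum, mul_sum, sum_mul]
    refine sum_congr rfl fun j _ => ?_
    have e2 : qPow ((2 * (j : ℤ) - w) * h) = qPow (-(h : ℤ)) ^ w * qPow 2 ^ (j * h) := by
      rw [qPow_pow, qPow_pow, ← qPow_add]
      congr 1
      push_cast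
      ring
    rw [e2, mul_add, pow_add, mul_one]
    ring

theorem qBounded_genFun (μ : YoungDiagram) : QBounded (genFun μ) := by
  intro h
  obtain ⟨N, hN⟩ := exists_coeff_eq_zero_of_ge (plethysmSL2 μ h * (T 1 - T (-1)))
  refine ⟨N, fun m h0 hm => ?_⟩
  change (if 1 ≤ m 1 then coeff μ (m 0) (m 1) else 0) = 0
  split_ifs with h1
  · rw [coeff_eq μ _ h1, h0]
    exact hN _ (by exact_mod_cast hm)
  · rfl

theorem zBounded_denom_mul_genFun (μ : YoungDiagram) :
    ZBounded ((denom μ.card : MvPowerSeries (Fin 2) ℤ) * genFun μ) := by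
  obtain ⟨γ, hγ, hsum⟩ := exists_expansion μ
  set w := μ.card with hw
  have hgen : genFun μ = ∑ j ∈ range (w + 1),
      posSeries (fun h => γ j * qPow ((2 * (j : ℤ) - w) * h)) := by
    rw [← posSeries_sum]
    ext m
    rw [coeff_posSeries, ← hsum, coeff_toSeries]
    change (if 1 ≤ m 1 then coeff μ (m 0) (m 1) else 0) = _
    split_ifs with h1
    · exact coeff_eq μ _ h1
    · rfl
  rw [hgen, mul_sum]
  refine ZBounded.sum _ fun j hj => ?_
  have hj' : j ≤ w := Nat.lt_succ_iff.1 (mem_range.1 hj)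
  rcases lt_trichotomy w (2 * j) with h | h | h
  · obtain ⟨a, ha⟩ : ∃ a, 2 * j = w + a := ⟨2 * j - w, by omega⟩
    have e : 2 * (j : ℤ) - w = a := by omega
    rw [e]
    exact (zBounded_of_pos (γ j) (by omega)).of_dvd
      (one_sub_dvd_denom (by omega) (by omega) ⟨j, by omega⟩)
  · have e : 2 * (j : ℤ) - w = -((0 : ℕ) : ℤ) := by
      push_cast
      omega
    simp only [e, neg_mul]
    refine (zBounded_of_neg (p := 1 - Polynomial.X) (r := 0) ?_ (Or.inr rfl)).of_dvd
      (aeval_one_sub_X_dvd_denom ⟨j, by omega⟩)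
    simp
  · obtain ⟨b, hb⟩ : ∃ b, w = 2 * j + b := ⟨w - 2 * j, by omega⟩
    have e : 2 * (j : ℤ) - w = -(b : ℤ) := by omega
    have hq1 : qPow 1 ∈ toSeries.range := ⟨T 1, toSeries_T 1⟩
    let x : toSeries.range := ⟨qPow 1, hq1⟩
    have hx : (x : LaurentSeries ℤ) = qPow 1 := rfl
    have hd := qPoch_dvd_aeval_zDenom x (w := w) (b := b) ⟨j + b, by omega⟩
    have h1 : γ j * ((qPoch (x ^ 2) w : toSeries.range) : LaurentSeries ℤ) ∈ toSeries.range := by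
      rw [coe_qPoch, Subring.coe_pow, hx, qPow_pow]
      exact hγ j hj'
    obtain ⟨r, hr⟩ := mul_mem_of_dvd h1 hd
    have hcoe : ((Polynomial.aeval (x ^ b) (zDenom w) : toSeries.range) : LaurentSeries ℤ) =
        Polynomial.aeval (qPow b) (zDenom w) := by
      rw [Polynomial.aeval_def, Polynomial.aeval_def]
      have := Polynomial.hom_eval₂ (zDenom w) (algebraMap ℤ toSeries.range) toSeries.range.subtype
        (x ^ b)
      refine this.trans ?_
      congr 1
      · exact RingHom.ext_int _ _
      · rw [map_pow, Subring.coe_subtype, hx, qPow_pow, mul_one]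
    rw [hcoe] at hr
    simp only [e, neg_mul]
    exact (zBounded_of_neg hr.symm (Or.inl (by omega))).of_dvd (aeval_zDenom_dvd_denom w)

end

end SL2Plethysm

theorem mainTheorem1 (w : ℕ) (hw : 0 < w) (μ : YoungDiagram) (hμ : μ.card = w) :
    ∃ p : MvPolynomial (Fin 2) ℤ,
      (SL2Plethysm.denom w : MvPowerSeries (Fin 2) ℤ) * SL2Plethysm.genFun μ =
        (p : MvPowerSeries (Fin 2) ℤ) := by
  subst hμ
  exact SL2Plethysm.exists_mvPolynomial_eq (SL2Plethysm.zBounded_denom_mul_genFun μ)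
    ((SL2Plethysm.qBounded_genFun μ).coe_mul _)
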